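/- For a $C^*$-algebra $A$ (not necessarily unital or separable) let $A_\infty=\ell^\infty(\mathbb N,A)/c_0(\mathbb N,A)$ be its sequence algebra, and view $A$ inside $A_\infty$ as the (classes of) constant sequences. A $*$-homomorphism $\varphi\colon A\to B$ between $C^*$-algebras is called *sequentially split* if there is a $*$-homomorphism $\psi\colon B\to A_\infty$ such that $\psi\circ\varphi$ is the canonical inclusion $A\to A_\infty$. Ideals are closed and two-sided, $\overline{\varphi(E)B\varphi(E)}$ and $\overline{B\varphi(J)B}$ denote closed linear spans, $\otimes_{\max}$ is the maximal tensor product, and $\mathcal K$ denotes the compact operators on $\ell^2(\mathbb N)$. $\mathrm{Cu}(A)$ is the Cuntz semigroup: classes $\langle a\rangle_A$ of positive elements $a\in A\otimes\mathcal K$, where $\langle a\rangle_A\le\langle b\rangle_A$ if there are $v_n\in A\otimes\mathcal K$ with $v_nbv_n^*\to a$. $K$-theory with coefficients is $K_*(A;\mathbb Z_n)=K_*(A\otimes C_0(W_n))$, where $W_n$ is the Moore space obtained by attaching a disk to the circle along a map of degree $n$, with its base point removed. $T(A)$ is the set of tracial states of $A$. **Theorem.** Let $A$ and $B$ be $C^*$-algebras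 and let $\varphi\colon A\to B$ be a sequentially split $*$-homomorphism. Then: 1. For each hereditary $C^*$-subalgebra $E\subseteq A$, the restriction $\varphi|_E\colon E\to\overline{\varphi(E)B\varphi(E)}$ is sequentially split. 2. For each ideal $J$ of $A$, the restriction $\varphi|_J\colon J\to\overline{B\varphi(J)B}$ and the induced map $A/J\to B/\overline{B\varphi(J)B}$ are sequentially split. 3. The map $J\mapsto\overline{B\varphi(J)B}$ from the ideals of $A$ to the ideals of $B$ is injective. 4. If $\rho\colon C\to D$ is another sequentially split $*$-homomorphism between $C^*$-algebras, then $\varphi\otimes\rho\colon A\otimes_{\max}C\to B\otimes_{\max}D$ is sequentially split. 5. The induced map $\mathrm{Cu}(A)\to\mathrm{Cu}(B)$, $\langle a\rangle_A\mapsto\langle(\varphi\otimes\mathrm{id}_{\mathcal K})(a)\rangle_B$, is an order embedding: $x\le y$ in $\mathrm{Cu}(A)$ if and only if the image of $x$ is $\le$ the image of $y$ in $\mathrm{Cu}(B)$. 6. $K_0(\varphi)\colon K_0(A)\to K_0(B)$ and $K_1(\varphi)\colon K_1(A)\to K_1(B)$ are injective, and so are the induced maps $K_0(A;\mathbb Z_n)\to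 K_0(B;\mathbb Z_n)$ and $K_1(A;\mathbb Z_n)\to K_1(B;\mathbb Z_n)$ for all $n\ge2$. 7. Every tracial state on $A$ is of the form $\tau\circ\varphi$ for some tracial state $\tau$ on $B$. (In particular, whenever $\tau\mapsto\tau\circ\varphi$ maps $T(B)$ into $T(A)$, for instance if $\varphi$ is non-degenerate, the induced map $T(B)\to T(A)$ is surjective.) -/

import Mathlib

universe u v w x

noncomputable section

open Filter Topology
open scoped ENNReal TensorProduct


/-! ### Closed ideals and quotients of C⋆-algebras -/

/-- A closed two-sided ideal of a C⋆-algebra. -/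
structure ClosedIdeal (A : Type u) [NonUnitalCStarAlgebra A] extends Submodule ℂ A where
  mul_mem_left' : ∀ (a : A) {j : A}, j ∈ carrier → a * j ∈ carrier
  mul_mem_right' : ∀ {j : A} (a : A), j ∈ carrier → j * a ∈ carrier
  isClosed' : IsClosed carrier

section approx

/-- Approximate units of a closed `*`-subalgebra. -/
theorem exists_approx_unit {A : Type u} [NonUnitalCStarAlgebra A]
    (S : NonUnitalStarSubalgebra ℂ A) (hS : IsClosed (S : Set A)) :
    ∃ l : Filter S, l.NeBot ∧ (∀ m : S, Tendsto (fun e : S => e * m) l (𝓝 m)) ∧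
      (∀ m : S, Tendsto (fun e : S => m * e) l (𝓝 m)) ∧
      (∀ᶠ e : S in l, star e = e) ∧ (∀ᶠ e : S in l, ‖(e : A)‖ ≤ 1) ∧
      ∀ᶠ e : S in l, ∀ z : A, ‖z - (e : A) * z‖ ≤ ‖z‖ := by
  have := hS
  let _ : PartialOrder S := CStarAlgebra.spectralOrder S
  have : StarOrderedRing S := CStarAlgebra.spectralOrderedRing S
  let _ : PartialOrder A := CStarAlgebra.spectralOrder A
  have : StarOrderedRing A := CStarAlgebra.spectralOrderedRing A
  have h := CStarAlgebra.increasingApproximateUnit S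
  refine ⟨CStarAlgebra.approximateUnit S, h.neBot, h.tendsto_mul_right, h.tendsto_mul_left,
    h.eventually_star_eq, h.eventually_norm, ?_⟩
  filter_upwards [h.eventually_nonneg, h.eventually_norm] with e he hn z
  have he' : (0 : A) ≤ (e : A) := by
    obtain ⟨s, hs⟩ := CStarAlgebra.nonneg_iff_eq_star_mul_self.1 he
    have : (e : A) = star (s : A) * (s : A) := congrArg Subtype.val hs
    rw [this]
    exact star_mul_self_nonneg _
  refine CStarAlgebra.norm_sub_mul_self_le_of_inr z le_rfl he' hn (norm_nonneg z) ?_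
  rw [Unitization.inr_zero, sub_zero, mul_one, CStarRing.norm_star_mul_self,
    Unitization.norm_inr, sq]

end approx

namespace ClosedIdeal

variable {A : Type u} [NonUnitalCStarAlgebra A]

instance : SetLike (ClosedIdeal A) A where
  coe J := J.carrier
  coe_injective J K h := by
    cases J with | mk J _ _ _ => cases K with | mk K _ _ _ =>
    have : J = K := SetLike.coe_injective h
    subst this; rfl

theorem mem_toSubmodule {J : ClosedIdeal A} {a : A} : a ∈ J.toSubmodule ↔ a ∈ J := Iff.rfl

theorem mul_mem_left (J : ClosedIdeal A) (a : A) {j : A} (hj : j ∈ J) : a * j ∈ J :=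
  J.mul_mem_left' a hj

theorem mul_mem_right (J : ClosedIdeal A) {j : A} (a : A) (hj : j ∈ J) : j * a ∈ J :=
  J.mul_mem_right' a hj

instance : NonUnitalSubringClass (ClosedIdeal A) A where
  add_mem {J} _ _ := J.toSubmodule.add_mem
  zero_mem J := J.toSubmodule.zero_mem
  neg_mem {J} _ := J.toSubmodule.neg_mem
  mul_mem {J} a _ _ hb := J.mul_mem_left a hb

instance : SMulMemClass (ClosedIdeal A) ℂ A where
  smul_mem {J} c _ h := J.toSubmodule.smul_mem c h

instance isClosed (J : ClosedIdeal A) : IsClosed (J : Set A) := J.isClosed'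

instance isClosed_toSubmodule (J : ClosedIdeal A) : IsClosed (J.toSubmodule : Set A) := J.isClosed'

/-- The self-adjoint part `J ∩ J⋆`; it is all of `J` by `ClosedIdeal.star_mem`. -/
def symm (J : ClosedIdeal A) : NonUnitalStarSubalgebra ℂ A where
  carrier := {a | a ∈ J ∧ star a ∈ J}
  add_mem' ha hb := ⟨add_mem ha.1 hb.1, by rw [star_add]; exact add_mem ha.2 hb.2⟩
  zero_mem' := ⟨zero_mem J, by rw [star_zero]; exact zero_mem J⟩
  mul_mem' ha hb := ⟨mul_mem ha.1 hb.1, by rw [star_mul]; exact mul_mem hb.2 ha.2⟩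
  smul_mem' c _ ha := ⟨SMulMemClass.smul_mem c ha.1, by
    rw [star_smul]; exact SMulMemClass.smul_mem _ ha.2⟩
  star_mem' ha := ⟨ha.2, by rw [star_star]; exact ha.1⟩

theorem isClosed_symm (J : ClosedIdeal A) : IsClosed (J.symm : Set A) :=
  J.isClosed.inter (J.isClosed.preimage continuous_star)

/-- Closed two-sided ideals of C⋆-algebras are self-adjoint. -/
theorem star_mem (J : ClosedIdeal A) {a : A} (ha : a ∈ J) : star a ∈ J := by
  obtain ⟨l, hl, h1, h2, hs, hn, hz⟩ := exists_approx_unit J.symm J.isClosed_symm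
  have hm : star a * a ∈ J.symm :=
    ⟨J.mul_mem_left _ ha, by rw [star_mul, star_star]; exact J.mul_mem_left _ ha⟩
  have key : Tendsto (fun e : J.symm => (e : A) * star a) l (𝓝 (star a)) := by
    rw [tendsto_iff_norm_sub_tendsto_zero]
    have h3 : Tendsto (fun e : J.symm => ‖(e : A) * (star a * a) - star a * a‖) l (𝓝 0) := by
      have := (continuous_subtype_val.tendsto _).comp (h1 ⟨star a * a, hm⟩)
      exact tendsto_iff_norm_sub_tendsto_zero.1 this
    have h4 : Tendsto (fun e : J.symm => Real.sqrt (2 * ‖(e : A) * (star a * a) - star a * a‖)) l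
        (𝓝 0) := by
      have := (Real.continuous_sqrt.tendsto _).comp (h3.const_mul 2)
      rw [mul_zero, Real.sqrt_zero] at this
      exact this
    refine squeeze_zero' (Eventually.of_forall fun _ => norm_nonneg _) ?_ h4
    filter_upwards [hs, hn] with e hse hne
    have hse' : star (e : A) = e := congrArg Subtype.val hse
    apply Real.le_sqrt_of_sq_le
    have e1 : ((e : A) * star a - star a) * star ((e : A) * star a - star a) =
        ((e : A) * (star a * a) - star a * a) * (e : A) -
          ((e : A) * (star a * a) - star a * a) := by
      simp only [star_sub, star_mul, star_star, hse', mul_sub, sub_mul, mul_assoc]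
    rw [sq, ← CStarRing.norm_self_mul_star, e1]
    refine (norm_sub_le _ _).trans ?_
    have := norm_mul_le ((e : A) * (star a * a) - star a * a) (e : A)
    nlinarith [norm_nonneg ((e : A) * (star a * a) - star a * a)]
  exact J.isClosed.mem_of_tendsto key
    (Eventually.of_forall fun e => J.mul_mem_right _ e.2.1)

instance : StarMemClass (ClosedIdeal A) A where
  star_mem {J} _ h := J.star_mem h

/-- The quotient `A / J`, with the quotient norm. -/
def Quotient (J : ClosedIdeal A) : Type u := A ⧸ J.toSubmodule

namespace Quotient

variable (J : ClosedIdeal A)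

instance : NormedAddCommGroup J.Quotient :=
  inferInstanceAs (NormedAddCommGroup (A ⧸ J.toSubmodule))

instance : NormedSpace ℂ J.Quotient := inferInstanceAs (NormedSpace ℂ (A ⧸ J.toSubmodule))

instance : CompleteSpace J.Quotient := inferInstanceAs (CompleteSpace (A ⧸ J.toSubmodule))

/-- The class of an element. -/
def of (a : A) : J.Quotient := Submodule.Quotient.mk (p := J.toSubmodule) a

theorem of_surjective : Function.Surjective (of J) :=
  Submodule.Quotient.mk_surjective J.toSubmodule

theorem of_eq {a b : A} : of J a = of J b ↔ a - b ∈ J :=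
  Submodule.Quotient.eq J.toSubmodule

theorem of_add (a b : A) : of J (a + b) = of J a + of J b := rfl

theorem of_zero : of J 0 = 0 := rfl

theorem of_smul (c : ℂ) (a : A) : of J (c • a) = c • of J a := rfl

theorem of_neg (a : A) : of J (-a) = - of J a := rfl

theorem of_sub (a b : A) : of J (a - b) = of J a - of J b := rfl

theorem norm_of_le (a : A) : ‖of J a‖ ≤ ‖a‖ := Submodule.Quotient.norm_mk_le J.toSubmodule a

theorem exists_norm_lt (q : J.Quotient) {ε : ℝ} (hε : 0 < ε) :
    ∃ a : A, of J a = q ∧ ‖a‖ < ‖q‖ + ε :=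
  Submodule.Quotient.norm_mk_lt (S := J.toSubmodule) q hε

instance : Mul J.Quotient where
  mul := Quotient.map₂ (fun a b => a * b) (by
    intro a a' ha b b' hb
    rw [← Quotient.eq_iff_equiv] at ha hb ⊢
    have ha' : a - a' ∈ J := (of_eq J).1 ha
    have hb' : b - b' ∈ J := (of_eq J).1 hb
    refine (of_eq J).2 ?_
    have : a * b - a' * b' = a * (b - b') + (a - a') * b' := by
      simp only [mul_sub, sub_mul]; abel
    rw [this]
    exact add_mem (J.mul_mem_left _ hb') (J.mul_mem_right _ ha'))

theorem of_mul (a b : A) : of J (a * b) = of J a * of J b := rfl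

instance : Star J.Quotient where
  star := Quotient.map (fun a => star a) (by
    intro a a' ha
    rw [← Quotient.eq_iff_equiv] at ha ⊢
    have ha' : a - a' ∈ J := (of_eq J).1 ha
    refine (of_eq J).2 ?_
    rw [← star_sub]
    exact J.star_mem ha')

theorem of_star (a : A) : of J (star a) = star (of J a) := rfl

instance : NonUnitalNormedRing J.Quotient :=
  { (inferInstance : NormedAddCommGroup J.Quotient) with
    mul := (· * ·)
    left_distrib := by
      intro a b c
      obtain ⟨a, rfl⟩ := of_surjective J a
      obtain ⟨b, rfl⟩ := of_surjective J b
      obtain ⟨c, rfl⟩ := of_surjective J c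
      simp only [← of_mul, ← of_add, mul_add]
    right_distrib := by
      intro a b c
      obtain ⟨a, rfl⟩ := of_surjective J a
      obtain ⟨b, rfl⟩ := of_surjective J b
      obtain ⟨c, rfl⟩ := of_surjective J c
      simp only [← of_mul, ← of_add, add_mul]
    zero_mul := by
      intro a
      obtain ⟨a, rfl⟩ := of_surjective J a
      rw [← of_zero, ← of_mul, zero_mul]
    mul_zero := by
      intro a
      obtain ⟨a, rfl⟩ := of_surjective J a
      rw [← of_zero, ← of_mul, mul_zero]
    mul_assoc := by
      intro a b c
      obtain ⟨a, rfl⟩ := of_surjective J a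
      obtain ⟨b, rfl⟩ := of_surjective J b
      obtain ⟨c, rfl⟩ := of_surjective J c
      simp only [← of_mul, mul_assoc]
    norm_mul_le := by
      intro p q
      have h : ∀ ε : ℝ, 0 < ε → ‖p * q‖ ≤ (‖p‖ + ε) * (‖q‖ + ε) := by
        intro ε hε
        obtain ⟨a, rfl, ha⟩ := exists_norm_lt J p hε
        obtain ⟨b, rfl, hb⟩ := exists_norm_lt J q hε
        rw [← of_mul]
        refine (norm_of_le J _).trans ((norm_mul_le _ _).trans ?_)
        gcongr
      have hc : Tendsto (fun ε : ℝ => (‖p‖ + ε) * (‖q‖ + ε)) (𝓝[>] 0)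
          (𝓝 ((‖p‖ + 0) * (‖q‖ + 0))) :=
        (Continuous.tendsto (by fun_prop) 0).mono_left nhdsWithin_le_nhds
      simp only [add_zero] at hc
      exact ge_of_tendsto hc (eventually_nhdsWithin_of_forall fun ε hε => h ε hε) }

instance : StarRing J.Quotient where
  star_involutive a := by
    obtain ⟨a, rfl⟩ := of_surjective J a
    rw [← of_star, ← of_star, star_star]
  star_mul a b := by
    obtain ⟨a, rfl⟩ := of_surjective J a
    obtain ⟨b, rfl⟩ := of_surjective J b
    simp only [← of_star, ← of_mul, star_mul]
  star_add a b := by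
    obtain ⟨a, rfl⟩ := of_surjective J a
    obtain ⟨b, rfl⟩ := of_surjective J b
    simp only [← of_star, ← of_add, star_add]

instance : CStarRing J.Quotient where
  norm_mul_self_le q := by
    obtain ⟨a, rfl⟩ := of_surjective J q
    obtain ⟨l, hl, h1, h2, hs, hn, hz⟩ := exists_approx_unit J.symm J.isClosed_symm
    rw [← of_star, ← of_mul]
    refine le_of_forall_pos_le_add fun ε hε => ?_
    obtain ⟨b, hb, hbn⟩ := exists_norm_lt J (of J (star a * a)) hε
    have hj : star a * a - b ∈ J := (of_eq J).1 hb.symm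
    have hj' : star a * a - b ∈ J.symm := ⟨hj, J.star_mem hj⟩
    have h3 : Tendsto (fun e : J.symm => ‖b‖ + ‖(e : A) * (star a * a - b) - (star a * a - b)‖) l
        (𝓝 (‖b‖ + 0)) := by
      have := (continuous_subtype_val.tendsto _).comp (h1 ⟨star a * a - b, hj'⟩)
      exact (tendsto_iff_norm_sub_tendsto_zero.1 this).const_add _
    rw [add_zero] at h3
    refine le_trans (ge_of_tendsto h3 ?_) hbn.le
    filter_upwards [hs, hz] with e hse hze
    have hse' : star (e : A) = e := congrArg Subtype.val hse
    have hze' : ∀ z : A, ‖z - z * (e : A)‖ ≤ ‖z‖ := fun z => by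
      have := hze (star z)
      rwa [norm_star, ← norm_star, star_sub, star_mul, star_star, hse'] at this
    have hae : of J a = of J (a - a * (e : A)) :=
      (of_eq J).2 (by rw [sub_sub_cancel]; exact J.mul_mem_left _ e.2.1)
    rw [hae]
    have hsplit : star (a - a * (e : A)) * (a - a * (e : A)) =
        ((b - (e : A) * b) - (b - (e : A) * b) * (e : A)) +
        (((star a * a - b) - (e : A) * (star a * a - b)) -
          ((star a * a - b) - (e : A) * (star a * a - b)) * (e : A)) := by
      simp only [star_sub, star_mul, hse', mul_sub, sub_mul, mul_assoc]
      abel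
    calc ‖of J (a - a * (e : A))‖ * ‖of J (a - a * (e : A))‖
        ≤ ‖a - a * (e : A)‖ * ‖a - a * (e : A)‖ := by
          gcongr <;> exact norm_of_le J _
      _ = ‖star (a - a * (e : A)) * (a - a * (e : A))‖ := (CStarRing.norm_star_mul_self).symm
      _ ≤ _ := by
          rw [hsplit]
          refine (norm_add_le _ _).trans (add_le_add ((hze' _).trans (hze _)) ?_)
          rw [norm_sub_rev ((e : A) * _)]
          exact hze' _

instance : NonUnitalCStarAlgebra J.Quotient where
  smul_assoc c a b := by
    obtain ⟨a, rfl⟩ := of_surjective J a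
    obtain ⟨b, rfl⟩ := of_surjective J b
    simp only [smul_eq_mul, ← of_mul, ← of_smul, smul_mul_assoc]
  smul_comm c a b := by
    obtain ⟨a, rfl⟩ := of_surjective J a
    obtain ⟨b, rfl⟩ := of_surjective J b
    simp only [smul_eq_mul, ← of_mul, ← of_smul, mul_smul_comm]
  star_smul c a := by
    obtain ⟨a, rfl⟩ := of_surjective J a
    simp only [← of_star, ← of_smul, star_smul]

/-- The quotient map `A → A / J`. -/
def mk : A →⋆ₙₐ[ℂ] J.Quotient where
  toFun := of J
  map_smul' _ _ := rfl
  map_zero' := rfl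
  map_add' _ _ := rfl
  map_mul' _ _ := rfl
  map_star' _ := rfl

end Quotient
end ClosedIdeal

namespace ClosedIdeal

variable {A : Type u} {B : Type v} [NonUnitalCStarAlgebra A] [NonUnitalCStarAlgebra B]

/-- The map `A / J → B / K` induced by a `*`-homomorphism `φ` with `φ(J) ⊆ K`. -/
def Quotient.map (φ : A →⋆ₙₐ[ℂ] B) (J : ClosedIdeal A) (K : ClosedIdeal B)
    (h : ∀ a ∈ J, φ a ∈ K) : J.Quotient →⋆ₙₐ[ℂ] K.Quotient where
  toFun := _root_.Quotient.map (fun a => φ a) (by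
    intro a a' ha
    rw [← Quotient.eq_iff_equiv] at ha ⊢
    have ha' : a - a' ∈ J := (Quotient.of_eq J).1 ha
    refine (Quotient.of_eq K).2 ?_
    rw [← map_sub]
    exact h _ ha')
  map_smul' c q := by
    obtain ⟨a, rfl⟩ := Quotient.of_surjective J q
    exact congrArg (Quotient.of K) (map_smul φ c a)
  map_zero' := congrArg (Quotient.of K) (map_zero φ)
  map_add' p q := by
    obtain ⟨a, rfl⟩ := Quotient.of_surjective J p
    obtain ⟨b, rfl⟩ := Quotient.of_surjective J q
    exact congrArg (Quotient.of K) (map_add φ a b)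
  map_mul' p q := by
    obtain ⟨a, rfl⟩ := Quotient.of_surjective J p
    obtain ⟨b, rfl⟩ := Quotient.of_surjective J q
    exact congrArg (Quotient.of K) (map_mul φ a b)
  map_star' q := by
    obtain ⟨a, rfl⟩ := Quotient.of_surjective J q
    exact congrArg (Quotient.of K) (map_star φ a)

theorem Quotient.map_mk (φ : A →⋆ₙₐ[ℂ] B) (J : ClosedIdeal A) (K : ClosedIdeal B)
    (h : ∀ a ∈ J, φ a ∈ K) (a : A) :
    Quotient.map φ J K h (Quotient.mk J a) = Quotient.mk K (φ a) := rfl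

/-- The closed ideal generated by `φ(J)`, i.e. the closed linear span of `B φ(J) B`. -/
def map (φ : A →⋆ₙₐ[ℂ] B) (J : ClosedIdeal A) : ClosedIdeal B where
  toSubmodule :=
    (Submodule.span ℂ {x : B | ∃ b, ∃ j ∈ J, ∃ b', x = b * φ j * b'}).topologicalClosure
  mul_mem_left' c x hx := by
    refine map_mem_closure (f := fun y => c * y) (by fun_prop) hx fun y hy => ?_
    induction hy using Submodule.span_induction with
    | mem y hy =>
      obtain ⟨b, j, hj, b', rfl⟩ := hy
      exact Submodule.subset_span ⟨c * b, j, hj, b', by simp only [mul_assoc]⟩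
    | zero => simp
    | add y z _ _ hy hz => simp only [mul_add]; exact Submodule.add_mem _ hy hz
    | smul r y _ hy => simp only [mul_smul_comm]; exact Submodule.smul_mem _ _ hy
  mul_mem_right' {x} c hx := by
    refine map_mem_closure (f := fun y => y * c) (by fun_prop) hx fun y hy => ?_
    induction hy using Submodule.span_induction with
    | mem y hy =>
      obtain ⟨b, j, hj, b', rfl⟩ := hy
      exact Submodule.subset_span ⟨b, j, hj, b' * c, by simp only [mul_assoc]⟩
    | zero => simp
    | add y z _ _ hy hz => simp only [add_mul]; exact Submodule.add_mem _ hy hz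
    | smul r y _ hy => simp only [smul_mul_assoc]; exact Submodule.smul_mem _ _ hy
  isClosed' := Submodule.isClosed_topologicalClosure _

end ClosedIdeal

/-- For a closed `*`-subalgebra `E`, every `φ e` with `e ∈ E` is a limit of elements
`φ(e₁) φ(e) φ(e₂)` with `e₁, e₂ ∈ E`. -/
theorem mem_closure_of_approx {A : Type u} {B : Type v} [NonUnitalCStarAlgebra A]
    [NonUnitalCStarAlgebra B] (φ : A →⋆ₙₐ[ℂ] B) (E : NonUnitalStarSubalgebra ℂ A)
    (hE : IsClosed (E : Set A)) {e : A} (he : e ∈ E) :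
    φ e ∈ closure {x : B | ∃ e₁ ∈ E, ∃ e₂ ∈ E, x = φ e₁ * φ e * φ e₂} := by
  obtain ⟨l, hl, h1, h2, -⟩ := exists_approx_unit E hE
  have hc : Continuous φ := 
    AddMonoidHomClass.continuous_of_bound φ 1 fun a => by
      simpa using NonUnitalStarAlgHom.norm_apply_le φ a
  have t1 : Tendsto (fun d : E => φ ((d : A) * e)) l (𝓝 (φ e)) :=
    (hc.tendsto _).comp ((continuous_subtype_val.tendsto _).comp (h1 ⟨e, he⟩))
  refine isClosed_closure.mem_of_tendsto t1 (Eventually.of_forall fun d => ?_)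
  have t2 : Tendsto (fun d' : E => φ ((d : A) * e * d')) l (𝓝 (φ ((d : A) * e))) :=
    (hc.tendsto _).comp ((continuous_subtype_val.tendsto _).comp (h2 (d * (⟨e, he⟩ : E))))
  refine mem_closure_of_tendsto t2 (Eventually.of_forall fun d' => ?_)
  exact ⟨d, d.2, d', d'.2, by simp only [map_mul]⟩

namespace ClosedIdeal

variable {A : Type u} {B : Type v} [NonUnitalCStarAlgebra A] [NonUnitalCStarAlgebra B]

theorem apply_mem_map (φ : A →⋆ₙₐ[ℂ] B) (J : ClosedIdeal A) : ∀ a ∈ J, φ a ∈ J.map φ := by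
  intro a ha
  refine closure_mono ?_ (mem_closure_of_approx φ J.symm J.isClosed_symm ⟨ha, J.star_mem ha⟩)
  rintro x ⟨e₁, -, e₂, -, rfl⟩
  exact Submodule.subset_span ⟨_, a, ha, _, rfl⟩

/-- The restriction `φ|_J` of `φ`, from `J` to the closed linear span of `B φ(J) B`. -/
def restrict (φ : A →⋆ₙₐ[ℂ] B) (J : ClosedIdeal A) : J →⋆ₙₐ[ℂ] J.map φ where
  toFun a := ⟨φ a, J.apply_mem_map φ a a.2⟩
  map_smul' c a := Subtype.ext (map_smul φ c (a : A))
  map_zero' := Subtype.ext (map_zero φ)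
  map_add' a b := Subtype.ext (map_add φ (a : A) (b : A))
  map_mul' a b := Subtype.ext (map_mul φ (a : A) (b : A))
  map_star' a := Subtype.ext (map_star φ (a : A))

/-- The map from `A / J` to the quotient of `B` by the closed linear span of `B φ(J) B` induced
by `φ`. -/
def quotientMap (φ : A →⋆ₙₐ[ℂ] B) (J : ClosedIdeal A) :
    J.Quotient →⋆ₙₐ[ℂ] (J.map φ).Quotient :=
  Quotient.map φ J (J.map φ) (J.apply_mem_map φ)

end ClosedIdeal

/-! ### Hereditary subalgebras -/

/-- Positivity in a C⋆-algebra: being of the form `x⋆x`. -/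
def IsPosElem {A : Type u} [NonUnitalCStarAlgebra A] (a : A) : Prop := ∃ x : A, a = star x * x

section Hereditary

variable {A : Type u} {B : Type v} [NonUnitalCStarAlgebra A] [NonUnitalCStarAlgebra B]

/-- A `*`-subalgebra `E` is hereditary if `0 ≤ a ≤ e` and `e ∈ E` imply `a ∈ E`. -/
def IsHereditary (E : NonUnitalStarSubalgebra ℂ A) : Prop :=
  ∀ e ∈ E, ∀ a : A, IsPosElem a → IsPosElem (e - a) → a ∈ E

/-- The closed linear span of `φ(E) B φ(E)`. -/
def hereditaryImage (φ : A →⋆ₙₐ[ℂ] B) (E : NonUnitalStarSubalgebra ℂ A) :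
    NonUnitalStarSubalgebra ℂ B where
  toNonUnitalSubalgebra :=
    { (Submodule.span ℂ
        {x : B | ∃ e ∈ E, ∃ b, ∃ e' ∈ E, x = φ e * b * φ e'}).topologicalClosure with
      mul_mem' := by
        intro x y hx hy
        refine map_mem_closure₂ (f := fun p q : B => p * q) (by fun_prop) hx hy
          fun p hp q hq => ?_
        induction hp using Submodule.span_induction with
        | mem p hp =>
          obtain ⟨e, he, b, e', he', rfl⟩ := hp
          induction hq using Submodule.span_induction with
          | mem q hq =>
            obtain ⟨f, hf, c, f', hf', rfl⟩ := hq
            exact Submodule.subset_span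
              ⟨e, he, b * φ e' * φ f * c, f', hf', by simp only [mul_assoc]⟩
          | zero => simp
          | add y z _ _ hy hz => simp only [mul_add]; exact Submodule.add_mem _ hy hz
          | smul r y _ hy => simp only [mul_smul_comm]; exact Submodule.smul_mem _ _ hy
        | zero => simp
        | add y z _ _ hy hz => simp only [add_mul]; exact Submodule.add_mem _ hy hz
        | smul r y _ hy => simp only [smul_mul_assoc]; exact Submodule.smul_mem _ _ hy }
  star_mem' := by
    intro x hx
    refine map_mem_closure (f := fun p : B => star p) continuous_star hx fun p hp => ?_
    induction hp using Submodule.span_induction with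
    | mem p hp =>
      obtain ⟨e, he, b, e', he', rfl⟩ := hp
      exact Submodule.subset_span ⟨star e', star_mem he', star b, star e, star_mem he, by
        simp only [star_mul, map_star, mul_assoc]⟩
    | zero => simp
    | add y z _ _ hy hz => simp only [star_add]; exact Submodule.add_mem _ hy hz
    | smul r y _ hy => simp only [star_smul]; exact Submodule.smul_mem _ _ hy

instance isClosed_hereditaryImage (φ : A →⋆ₙₐ[ℂ] B) (E : NonUnitalStarSubalgebra ℂ A) :
    IsClosed (hereditaryImage φ E : Set B) := isClosed_closure

theorem apply_mem_hereditaryImage (φ : A →⋆ₙₐ[ℂ] B) (E : NonUnitalStarSubalgebra ℂ A)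
    [hE : IsClosed (E : Set A)] {e : A} (he : e ∈ E) : φ e ∈ hereditaryImage φ E := by
  refine closure_mono ?_ (mem_closure_of_approx φ E hE he)
  rintro x ⟨e₁, h₁, e₂, h₂, rfl⟩
  exact Submodule.subset_span ⟨e₁, h₁, _, e₂, h₂, rfl⟩

/-- The restriction `φ|_E` of `φ`, from `E` to the closed linear span of `φ(E) B φ(E)`. -/
def hereditaryRestrict (φ : A →⋆ₙₐ[ℂ] B) (E : NonUnitalStarSubalgebra ℂ A)
    [IsClosed (E : Set A)] : E →⋆ₙₐ[ℂ] hereditaryImage φ E :=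
  NonUnitalStarAlgHom.codRestrict (φ.comp (NonUnitalStarSubalgebraClass.subtype E))
    (hereditaryImage φ E) fun e => apply_mem_hereditaryImage φ E e.2

end Hereditary

/-! ### Sequence algebras and sequentially split `*`-homomorphisms -/

section SeqAlg

variable (A : Type u) [NonUnitalCStarAlgebra A]

/-- The ideal `c₀(ℕ, A)` of `ℓ^∞(ℕ, A)`. -/
def nullSequences : ClosedIdeal (lp (fun _ : ℕ => A) ∞) where
  carrier := {a | Tendsto (fun n => ‖a n‖) atTop (𝓝 0)}
  add_mem' {a b} ha hb := by
    refine squeeze_zero (fun _ => norm_nonneg _) (fun n => ?_) (by simpa using ha.add hb)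
    exact norm_add_le (a n) (b n)
  zero_mem' := by simp
  smul_mem' c a ha := by
    have := ha.const_mul ‖c‖
    rw [mul_zero] at this
    exact this.congr fun n => (norm_smul c (a n)).symm
  mul_mem_left' a j hj := by
    have hj : Tendsto (fun n => ‖j n‖) atTop (𝓝 0) := hj
    refine squeeze_zero (fun _ => norm_nonneg _) (fun n => ?_)
      (by simpa using hj.const_mul ‖a‖)
    exact (norm_mul_le (a n) (j n)).trans
      (mul_le_mul_of_nonneg_right (lp.norm_apply_le_norm ENNReal.top_ne_zero a n) (norm_nonneg _))
  mul_mem_right' {j} a hj := by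
    have hj : Tendsto (fun n => ‖j n‖) atTop (𝓝 0) := hj
    refine squeeze_zero (fun _ => norm_nonneg _) (fun n => ?_)
      (by simpa using hj.mul_const ‖a‖)
    exact (norm_mul_le (j n) (a n)).trans
      (mul_le_mul_of_nonneg_left (lp.norm_apply_le_norm ENNReal.top_ne_zero a n) (norm_nonneg _))
  isClosed' := by
    refine isClosed_of_closure_subset fun a ha => ?_
    refine Metric.tendsto_atTop.2 fun ε hε => ?_
    obtain ⟨b, hb, hab⟩ := Metric.mem_closure_iff.1 ha (ε / 2) (half_pos hε)
    obtain ⟨N, hN⟩ := Metric.tendsto_atTop.1 hb (ε / 2) (half_pos hε)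
    refine ⟨N, fun n hn => ?_⟩
    have h1 := hN n hn
    rw [dist_zero_right, norm_norm] at h1 ⊢
    rw [dist_eq_norm] at hab
    have h2 : ‖a n - b n‖ ≤ ‖a - b‖ := lp.norm_apply_le_norm ENNReal.top_ne_zero (a - b) n
    have h3 : ‖a n‖ ≤ ‖a n - b n‖ + ‖b n‖ := by simpa using norm_add_le (a n - b n) (b n)
    linarith

/-- The sequence algebra `A_∞ = ℓ^∞(ℕ, A) / c₀(ℕ, A)`. -/
abbrev SeqAlg : Type u := (nullSequences A).Quotient

variable {A}

/-- A constant sequence. -/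
def constSeq (a : A) : lp (fun _ : ℕ => A) ∞ :=
  ⟨fun _ => a, memℓp_infty ⟨‖a‖, by rintro _ ⟨_, rfl⟩; exact le_rfl⟩⟩

variable (A)

/-- The canonical inclusion `A → A_∞` as constant sequences. -/
def seqIncl : A →⋆ₙₐ[ℂ] SeqAlg A :=
  (ClosedIdeal.Quotient.mk (nullSequences A)).comp
    { toFun := constSeq
      map_smul' := fun _ _ => rfl
      map_zero' := rfl
      map_add' := fun _ _ => rfl
      map_mul' := fun _ _ => rfl
      map_star' := fun _ => rfl }

end SeqAlg

/-- A `*`-homomorphism `φ : A → B` is sequentially split if there is a `*`-homomorphism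
`ψ : B → A_∞` such that `ψ ∘ φ` is the canonical inclusion `A → A_∞`. -/
def SeqSplit {A : Type u} {B : Type v} [NonUnitalCStarAlgebra A] [NonUnitalCStarAlgebra B]
    (φ : A →⋆ₙₐ[ℂ] B) : Prop :=
  ∃ ψ : B →⋆ₙₐ[ℂ] SeqAlg A, ψ.comp φ = seqIncl A


/-! ### C⋆-seminorms and the maximal tensor product -/

/-- A C⋆-seminorm on a complex `*`-algebra. -/
structure CStarSeminorm (T : Type u) [NonUnitalRing T] [StarRing T] [Module ℂ T] extends
    Seminorm ℂ T where
  mul_le' : ∀ x y, toFun (x * y) ≤ toFun x * toFun y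
  star_mul_self' : ∀ x, toFun (star x * x) = toFun x * toFun x

namespace CStarSeminorm

section Basic

variable {T : Type u} [NonUnitalRing T] [StarRing T] [Module ℂ T]

instance : FunLike (CStarSeminorm T) T ℝ where
  coe p := p.toFun
  coe_injective p q h := by
    cases p with | mk p _ _ => cases q with | mk q _ _ =>
    have : p = q := DFunLike.coe_injective h
    subst this; rfl

instance : SeminormClass (CStarSeminorm T) ℂ T where
  map_add_le_add p := map_add_le_add p.toSeminorm
  map_zero p := map_zero p.toSeminorm
  map_neg_eq_map p := map_neg_eq_map p.toSeminorm
  map_smul_eq_mul p := map_smul_eq_mul p.toSeminorm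

theorem mul_le (p : CStarSeminorm T) (x y : T) : p (x * y) ≤ p x * p y := p.mul_le' x y

theorem star_mul_self (p : CStarSeminorm T) (x : T) : p (star x * x) = p x * p x :=
  p.star_mul_self' x

theorem apply_star (p : CStarSeminorm T) (x : T) : p (star x) = p x := by
  have key : ∀ y : T, p y ≤ p (star y) := by
    intro y
    rcases (apply_nonneg p y).eq_or_lt with h | h
    · rw [← h]; exact apply_nonneg p _
    · have h1 := p.mul_le (star y) y
      rw [star_mul_self] at h1
      exact le_of_mul_le_mul_right h1 h
  refine le_antisymm ?_ (key x)
  simpa using key (star x)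

/-- The zero seminorm. -/
def zero : CStarSeminorm T where
  toSeminorm := 0
  mul_le' _ _ := (mul_zero (0 : ℝ)).ge
  star_mul_self' _ := (mul_zero (0 : ℝ)).symm

/-- The `*`-algebra `T`, equipped with the seminorm `p`. -/
def Carrier (_p : CStarSeminorm T) : Type u := T

end Basic

variable {T : Type u} [NonUnitalRing T] [StarRing T] [Module ℂ T] (p : CStarSeminorm T)

instance : NonUnitalSeminormedRing p.Carrier :=
  { AddGroupSeminorm.toSeminormedAddCommGroup (E := T) p.toSeminorm.toAddGroupSeminorm,
    (inferInstance : NonUnitalRing T) with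
    norm_mul_le := p.mul_le }

instance : StarRing p.Carrier where
  star := (star : T → T)
  star_involutive := (star_star : ∀ x : T, star (star x) = x)
  star_mul := (star_mul : ∀ x y : T, star (x * y) = star y * star x)
  star_add := (star_add : ∀ x y : T, star (x + y) = star x + star y)

instance : NormedSpace ℂ p.Carrier :=
  { (inferInstance : Module ℂ T) with
    norm_smul_le := fun c x => (map_smul_eq_mul p.toSeminorm c x).le }

instance : NormedStarGroup p.Carrier where
  norm_star_le x := (p.apply_star x).le

/-- The C⋆-algebra obtained from `T` by dividing out the null space of `p` and completing. -/
def Completion : Type u := UniformSpace.Completion p.Carrier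

namespace Completion

instance : NormedAddCommGroup p.Completion :=
  inferInstanceAs (NormedAddCommGroup (UniformSpace.Completion p.Carrier))

instance : NormedSpace ℂ p.Completion :=
  inferInstanceAs (NormedSpace ℂ (UniformSpace.Completion p.Carrier))

instance : CompleteSpace p.Completion :=
  inferInstanceAs (CompleteSpace (UniformSpace.Completion p.Carrier))

/-- The canonical map from `T` to its completion. -/
def of (t : T) : p.Completion := UniformSpace.Completion.coe' (α := p.Carrier) t

theorem denseRange_of : DenseRange (of p) :=
  UniformSpace.Completion.denseRange_coe (α := p.Carrier)

theorem norm_of (t : T) : ‖of p t‖ = p t := UniformSpace.Completion.norm_coe (E := p.Carrier) t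

theorem of_add (s t : T) : of p (s + t) = of p s + of p t :=
  UniformSpace.Completion.coe_add (α := p.Carrier) s t

theorem of_zero : of p 0 = 0 := rfl

theorem of_smul (c : ℂ) (t : T) : of p (c • t) = c • of p t :=
  UniformSpace.Completion.coe_smul (X := p.Carrier) c t

instance : Mul p.Completion where
  mul := Function.curry <|
    (UniformSpace.Completion.isDenseInducing_coe.prodMap
      UniformSpace.Completion.isDenseInducing_coe).extend
      (fun q : p.Carrier × p.Carrier => of p (q.1 * q.2))

theorem of_mul (s t : T) : of p (s * t) = of p s * of p t :=
  ((UniformSpace.Completion.isDenseInducing_coe.prodMap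
    UniformSpace.Completion.isDenseInducing_coe).extend_eq
    ((UniformSpace.Completion.continuous_coe p.Carrier).comp
      (continuous_mul (M := p.Carrier))) (s, t)).symm

instance : ContinuousMul p.Completion where
  continuous_mul := by
    let m := (AddMonoidHom.mul : p.Carrier →+ p.Carrier →+ p.Carrier).compr₂
      UniformSpace.Completion.toCompl
    have : Continuous fun q : p.Carrier × p.Carrier => m q.1 q.2 :=
      (UniformSpace.Completion.continuous_coe p.Carrier).comp continuous_mul
    have di : IsDenseInducing
        (UniformSpace.Completion.toCompl : p.Carrier → UniformSpace.Completion p.Carrier) :=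
      UniformSpace.Completion.isDenseInducing_coe
    exact (di.extend_Z_bilin di this :)

instance : Star p.Completion where
  star := UniformSpace.Completion.map (fun t : p.Carrier => star t)

theorem continuous_star' : Continuous (fun q : p.Completion => star q) :=
  UniformSpace.Completion.continuous_map

theorem of_star (t : T) : of p (star t) = star (of p t) :=
  (UniformSpace.Completion.map_coe (f := fun t : p.Carrier => star t)
    (AddMonoidHomClass.isometry_of_norm (starAddEquiv : p.Carrier ≃+ p.Carrier)
      (fun x => norm_star x)).uniformContinuous t).symm

@[elab_as_elim]
theorem ind {P : p.Completion → Prop} (q : p.Completion) (hc : IsClosed {q | P q})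
    (h : ∀ t, P (of p t)) : P q :=
  (denseRange_of p).induction_on q hc h

@[elab_as_elim]
theorem ind₂ {P : p.Completion → p.Completion → Prop} (q r : p.Completion)
    (hc : IsClosed {q : p.Completion × p.Completion | P q.1 q.2})
    (h : ∀ s t, P (of p s) (of p t)) : P q r :=
  (denseRange_of p).induction_on₂ hc h q r

@[elab_as_elim]
theorem ind₃ {P : p.Completion → p.Completion → p.Completion → Prop} (q r s : p.Completion)
    (hc : IsClosed {q : p.Completion × p.Completion × p.Completion | P q.1 q.2.1 q.2.2})
    (h : ∀ s t u, P (of p s) (of p t) (of p u)) : P q r s :=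
  (denseRange_of p).induction_on₃ hc h q r s

instance : NonUnitalNormedRing p.Completion :=
  { (inferInstance : NormedAddCommGroup p.Completion) with
    mul := (· * ·)
    left_distrib := fun a b c => ind₃ p a b c (isClosed_eq (by fun_prop) (by fun_prop))
      fun a b c => by simp only [← of_mul, ← of_add, mul_add]
    right_distrib := fun a b c => ind₃ p a b c (isClosed_eq (by fun_prop) (by fun_prop))
      fun a b c => by simp only [← of_mul, ← of_add, add_mul]
    zero_mul := fun a => ind p a (isClosed_eq (by fun_prop) (by fun_prop))
      fun a => by rw [← of_zero, ← of_mul, zero_mul]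
    mul_zero := fun a => ind p a (isClosed_eq (by fun_prop) (by fun_prop))
      fun a => by rw [← of_zero, ← of_mul, mul_zero]
    mul_assoc := fun a b c => ind₃ p a b c (isClosed_eq (by fun_prop) (by fun_prop))
      fun a b c => by simp only [← of_mul, mul_assoc]
    norm_mul_le := fun a b => ind₂ p a b (isClosed_le (by fun_prop) (by fun_prop))
      fun a b => by rw [← of_mul, norm_of, norm_of, norm_of]; exact p.mul_le a b }

instance : StarRing p.Completion where
  star_involutive a := ind p a
    (isClosed_eq ((continuous_star' p).comp (continuous_star' p)) continuous_id)
      fun a => by rw [← of_star, ← of_star, star_star]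
  star_mul a b := ind₂ p a b
    (isClosed_eq ((continuous_star' p).comp (by fun_prop))
      (((continuous_star' p).comp continuous_snd).mul ((continuous_star' p).comp continuous_fst)))
      fun a b => by simp only [← of_star, ← of_mul, star_mul]
  star_add a b := ind₂ p a b
    (isClosed_eq ((continuous_star' p).comp (by fun_prop))
      (((continuous_star' p).comp continuous_fst).add ((continuous_star' p).comp continuous_snd)))
      fun a b => by simp only [← of_star, ← of_add, star_add]

instance : CStarRing p.Completion where
  norm_mul_self_le a := ind p a
    (isClosed_le (by fun_prop)
      (continuous_norm.comp ((continuous_star' p).mul continuous_id)))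
      fun a => by rw [← of_star, ← of_mul, norm_of, norm_of, p.star_mul_self]

instance [IsScalarTower ℂ T T] [SMulCommClass ℂ T T] [StarModule ℂ T] :
    NonUnitalCStarAlgebra p.Completion where
  smul_assoc c a b := ind₂ p a b
    (isClosed_eq ((continuous_fst.const_smul c).mul continuous_snd)
      ((continuous_fst.mul continuous_snd).const_smul c))
    fun a b => by simp only [smul_eq_mul, ← of_smul, ← of_mul, smul_mul_assoc]
  smul_comm c a b := ind₂ p a b
    (isClosed_eq ((continuous_fst.mul continuous_snd).const_smul c)
      (continuous_fst.mul (continuous_snd.const_smul c)))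
    fun a b => by simp only [smul_eq_mul, ← of_smul, ← of_mul, mul_smul_comm]
  star_smul c a := ind p a
    (isClosed_eq ((continuous_star' p).comp (continuous_id.const_smul c))
      ((continuous_star' p).const_smul (star c)))
    fun a => by simp only [← of_star, ← of_smul, star_smul]

variable {S : Type v} [NonUnitalRing S] [StarRing S] [Module ℂ S]

/-- The function underlying `CStarSeminorm.Completion.map`. -/
def mapFun (p : CStarSeminorm T) (q : CStarSeminorm S) (f : T →⋆ₙₐ[ℂ] S) :
    p.Completion → q.Completion :=
  UniformSpace.Completion.map (α := p.Carrier) (β := q.Carrier) f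

theorem continuous_mapFun (p : CStarSeminorm T) (q : CStarSeminorm S) (f : T →⋆ₙₐ[ℂ] S) :
    Continuous (mapFun p q f) :=
  UniformSpace.Completion.continuous_map (α := p.Carrier) (β := q.Carrier)

theorem mapFun_of (p : CStarSeminorm T) (q : CStarSeminorm S) (f : T →⋆ₙₐ[ℂ] S)
    (hf : ∀ t, q (f t) ≤ p t) (t : T) : mapFun p q f (of p t) = of q (f t) :=
  let F : p.Carrier →ₗ[ℂ] q.Carrier :=
    { toFun := fun t => f t, map_add' := map_add f, map_smul' := map_smul f }
  UniformSpace.Completion.map_coe (f := F)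
    (F.mkContinuous 1 fun t => by rw [one_mul]; exact hf t).uniformContinuous t

/-- The `*`-homomorphism between completions extending a `*`-homomorphism `f` that does not
increase the seminorms. -/
def map (p : CStarSeminorm T) (q : CStarSeminorm S) (f : T →⋆ₙₐ[ℂ] S)
    (hf : ∀ t, q (f t) ≤ p t) : p.Completion →⋆ₙₐ[ℂ] q.Completion where
  toFun := mapFun p q f
  map_smul' c a := ind p a
    (isClosed_eq ((continuous_mapFun p q f).comp (continuous_id.const_smul c))
      ((continuous_mapFun p q f).const_smul c))
    fun a => by simp only [← of_smul, mapFun_of p q f hf, map_smul, MonoidHom.id_apply]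
  map_zero' := by rw [← of_zero p, mapFun_of p q f hf, map_zero, of_zero]
  map_add' a b := ind₂ p a b
    (isClosed_eq ((continuous_mapFun p q f).comp (continuous_fst.add continuous_snd))
      (((continuous_mapFun p q f).comp continuous_fst).add
        ((continuous_mapFun p q f).comp continuous_snd)))
    fun a b => by simp only [← of_add, mapFun_of p q f hf, map_add]
  map_mul' a b := ind₂ p a b
    (isClosed_eq ((continuous_mapFun p q f).comp (continuous_fst.mul continuous_snd))
      (((continuous_mapFun p q f).comp continuous_fst).mul
        ((continuous_mapFun p q f).comp continuous_snd)))
    fun a b => by simp only [← of_mul, mapFun_of p q f hf, map_mul]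
  map_star' a := ind p a
    (isClosed_eq ((continuous_mapFun p q f).comp (continuous_star' p))
      ((continuous_star' q).comp (continuous_mapFun p q f)))
    fun a => by simp only [← of_star, mapFun_of p q f hf, map_star]

theorem map_of (p : CStarSeminorm T) (q : CStarSeminorm S) (f : T →⋆ₙₐ[ℂ] S)
    (hf : ∀ t, q (f t) ≤ p t) (t : T) : map p q f hf (of p t) = of q (f t) :=
  mapFun_of p q f hf t

end Completion

/-- C⋆-seminorms are monotone: `x⋆x ≤ z⋆z` implies `p x ≤ p z`. -/
theorem le_of_add [IsScalarTower ℂ T T] [SMulCommClass ℂ T T] [StarModule ℂ T] (x z y : T) (h : star z * z = star x * x + star y * y) : p x ≤ p z := by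
  let _ : PartialOrder p.Completion := CStarAlgebra.spectralOrder p.Completion
  have : StarOrderedRing p.Completion := CStarAlgebra.spectralOrderedRing p.Completion
  have h1 : star (Completion.of p x) * Completion.of p x ≤
      star (Completion.of p z) * Completion.of p z := by
    have := congrArg (Completion.of p) h
    rw [Completion.of_add, Completion.of_mul, Completion.of_mul, Completion.of_mul,
      Completion.of_star, Completion.of_star, Completion.of_star] at this
    rw [this]
    exact le_add_of_nonneg_right (star_mul_self_nonneg _)
  have h2 := CStarAlgebra.norm_le_norm_of_nonneg_of_le (star_mul_self_nonneg _) h1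
  rw [CStarRing.norm_star_mul_self, CStarRing.norm_star_mul_self, Completion.norm_of,
    Completion.norm_of] at h2
  exact le_of_sq_le_sq (by rw [sq, sq]; exact h2) (apply_nonneg p z)

end CStarSeminorm

section Tensor

variable {A : Type u} {C : Type v} [NonUnitalCStarAlgebra A] [NonUnitalCStarAlgebra C]

theorem exists_compl_mul (a e : A) :
    ∃ y : A, (‖a‖ ^ 2 : ℂ) • (star e * e) = star (a * e) * (a * e) + star y * y := by
  let _ : PartialOrder A := CStarAlgebra.spectralOrder A
  have : StarOrderedRing A := CStarAlgebra.spectralOrderedRing A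
  have h := CStarAlgebra.star_left_conjugate_le_norm_smul (a := e) (b := star a * a)
    (IsSelfAdjoint.star_mul_self a)
  rw [← sub_nonneg] at h
  obtain ⟨y, hy⟩ := CStarAlgebra.nonneg_iff_eq_star_mul_self.1 h
  refine ⟨y, ?_⟩
  rw [← hy, CStarRing.norm_star_mul_self, star_mul, ← Complex.coe_smul]
  simp only [mul_assoc, Complex.ofReal_mul, sq]
  abel

/-- Every C⋆-seminorm on the algebraic tensor product is a subcross seminorm. -/
theorem CStarSeminorm.tmul_le (p : CStarSeminorm (A ⊗[ℂ] C)) (a : A) (c : C) :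
    p (a ⊗ₜ c) ≤ ‖a‖ * ‖c‖ := by
  have hA : ∀ (a e : A) (d : C), p ((a * e) ⊗ₜ d) ≤ ‖a‖ * p (e ⊗ₜ d) := by
    intro a e d
    obtain ⟨y, hy⟩ := exists_compl_mul a e
    have := p.le_of_add ((a * e) ⊗ₜ d) ((‖a‖ : ℂ) • (e ⊗ₜ d)) (y ⊗ₜ d) (by
      simp only [star_smul, TensorProduct.star_tmul, smul_mul_smul_comm,
        Algebra.TensorProduct.tmul_mul_tmul, ← TensorProduct.add_tmul, ← hy,
        TensorProduct.smul_tmul', Complex.star_def, Complex.conj_ofReal, sq])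
    rwa [map_smul_eq_mul, Complex.norm_real, norm_norm] at this
  have hC : ∀ (c d : C) (e : A), p (e ⊗ₜ (c * d)) ≤ ‖c‖ * p (e ⊗ₜ d) := by
    intro c d e
    obtain ⟨y, hy⟩ := exists_compl_mul c d
    have := p.le_of_add (e ⊗ₜ (c * d)) ((‖c‖ : ℂ) • (e ⊗ₜ d)) (e ⊗ₜ y) (by
      simp only [star_smul, TensorProduct.star_tmul, smul_mul_smul_comm,
        Algebra.TensorProduct.tmul_mul_tmul, ← TensorProduct.tmul_add, ← hy,
        TensorProduct.tmul_smul, Complex.star_def, Complex.conj_ofReal, sq])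
    rwa [map_smul_eq_mul, Complex.norm_real, norm_norm] at this
  have hsa : ∀ (a : A) (c : C), star a = a → star c = c → p (a ⊗ₜ c) ≤ ‖a‖ * ‖c‖ := by
    intro a c ha hc
    have h0 := apply_nonneg p (a ⊗ₜ c)
    rcases h0.eq_or_lt with h | h
    · rw [← h]; positivity
    have h1 := p.star_mul_self (a ⊗ₜ c)
    rw [TensorProduct.star_tmul, ha, hc, Algebra.TensorProduct.tmul_mul_tmul] at h1
    have h2 := (hA a a (c * c)).trans (mul_le_mul_of_nonneg_left (hC c c a) (norm_nonneg a))
    rw [h1, ← mul_assoc] at h2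
    exact le_of_mul_le_mul_right h2 h
  have h1 := p.star_mul_self (a ⊗ₜ c)
  have h2 := hsa (star a * a) (star c * c) (by simp) (by simp)
  rw [TensorProduct.star_tmul, Algebra.TensorProduct.tmul_mul_tmul] at h1
  rw [h1, CStarRing.norm_star_mul_self, CStarRing.norm_star_mul_self] at h2
  refine le_of_sq_le_sq ?_ (by positivity)
  nlinarith

theorem CStarSeminorm.bddAbove (x : A ⊗[ℂ] C) :
    BddAbove (Set.range fun p : CStarSeminorm (A ⊗[ℂ] C) => p x) := by
  induction x with
  | zero => exact ⟨0, by rintro _ ⟨p, rfl⟩; exact (map_zero p).le⟩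
  | tmul a c => exact ⟨‖a‖ * ‖c‖, by rintro _ ⟨p, rfl⟩; exact p.tmul_le a c⟩
  | add x y hx hy =>
    obtain ⟨M, hM⟩ := hx
    obtain ⟨N, hN⟩ := hy
    refine ⟨M + N, ?_⟩
    rintro _ ⟨p, rfl⟩
    exact (map_add_le_add p x y).trans (add_le_add (hM ⟨p, rfl⟩) (hN ⟨p, rfl⟩))

instance : Nonempty (CStarSeminorm (A ⊗[ℂ] C)) := ⟨CStarSeminorm.zero⟩

variable (A C)

/-- The maximal C⋆-norm on the algebraic tensor product: the supremum of all C⋆-seminorms. -/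
def maxTensorNorm : CStarSeminorm (A ⊗[ℂ] C) where
  toFun x := ⨆ p : CStarSeminorm (A ⊗[ℂ] C), p x
  map_zero' := by simp
  add_le' x y := ciSup_le fun p => (map_add_le_add p x y).trans
    (add_le_add (le_ciSup (CStarSeminorm.bddAbove x) p) (le_ciSup (CStarSeminorm.bddAbove y) p))
  neg' x := by simp
  smul' c x := by
    simp only [map_smul_eq_mul]
    rw [Real.mul_iSup_of_nonneg (norm_nonneg c)]
  mul_le' x y := ciSup_le fun p => (p.mul_le x y).trans
    (mul_le_mul (le_ciSup (CStarSeminorm.bddAbove x) p) (le_ciSup (CStarSeminorm.bddAbove y) p)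
      (apply_nonneg p y) (Real.iSup_nonneg fun p => apply_nonneg p x))
  star_mul_self' x := by
    have h0 : 0 ≤ ⨆ p : CStarSeminorm (A ⊗[ℂ] C), p x := Real.iSup_nonneg fun p => apply_nonneg p x
    have h1 : 0 ≤ ⨆ p : CStarSeminorm (A ⊗[ℂ] C), p (star x * x) :=
      Real.iSup_nonneg fun p => apply_nonneg p _
    refine le_antisymm (ciSup_le fun p => ?_) ?_
    · rw [p.star_mul_self]
      have := le_ciSup (CStarSeminorm.bddAbove x) p
      exact mul_le_mul this this (apply_nonneg p x) h0
    · rw [← sq]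
      refine (Real.le_sqrt h0 h1).1 (ciSup_le fun p => ?_)
      refine Real.le_sqrt_of_sq_le ?_
      rw [sq, ← p.star_mul_self]
      exact le_ciSup (CStarSeminorm.bddAbove (star x * x)) p

theorem le_maxTensorNorm (p : CStarSeminorm (A ⊗[ℂ] C)) (x : A ⊗[ℂ] C) :
    p x ≤ maxTensorNorm A C x :=
  le_ciSup (CStarSeminorm.bddAbove x) p

/-- The maximal tensor product `A ⊗_max C`. -/
def MaxTensor : Type (max u v) := (maxTensorNorm A C).Completion

instance : NonUnitalCStarAlgebra (MaxTensor A C) :=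
  inferInstanceAs (NonUnitalCStarAlgebra (maxTensorNorm A C).Completion)

end Tensor

namespace MaxTensor

variable {A : Type u} {B : Type v} {C : Type w} {D : Type x} [NonUnitalCStarAlgebra A]
  [NonUnitalCStarAlgebra B] [NonUnitalCStarAlgebra C] [NonUnitalCStarAlgebra D]

/-- The map `φ ⊙ ρ` between algebraic tensor products. -/
def algMap (φ : A →⋆ₙₐ[ℂ] B) (ρ : C →⋆ₙₐ[ℂ] D) : A ⊗[ℂ] C →⋆ₙₐ[ℂ] B ⊗[ℂ] D :=
  { TensorProduct.map (φ : A →ₗ[ℂ] B) (ρ : C →ₗ[ℂ] D) with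
    toFun := TensorProduct.map (φ : A →ₗ[ℂ] B) (ρ : C →ₗ[ℂ] D)
    map_zero' := map_zero _
    map_smul' := map_smul (TensorProduct.map (φ : A →ₗ[ℂ] B) (ρ : C →ₗ[ℂ] D))
    map_mul' := fun x y => by
      induction x with
      | zero => simp
      | add x x' hx hx' => simp only [add_mul, map_add, hx, hx']
      | tmul a c =>
        induction y with
        | zero => simp
        | add y y' hy hy' => simp only [mul_add, map_add, hy, hy']
        | tmul b d => simp
    map_star' := fun x => by
      induction x with
      | zero => simp
      | add x x' hx hx' => simp only [star_add, map_add, hx, hx']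
      | tmul a c => simp [map_star] }

theorem algMap_tmul (φ : A →⋆ₙₐ[ℂ] B) (ρ : C →⋆ₙₐ[ℂ] D) (a : A) (c : C) :
    algMap φ ρ (a ⊗ₜ c) = φ a ⊗ₜ ρ c := rfl

theorem algMap_le (φ : A →⋆ₙₐ[ℂ] B) (ρ : C →⋆ₙₐ[ℂ] D) (t : A ⊗[ℂ] C) :
    maxTensorNorm B D (algMap φ ρ t) ≤ maxTensorNorm A C t :=
  ciSup_le fun p =>
    le_maxTensorNorm A C
      { toFun := fun x => p (algMap φ ρ x)
        map_zero' := by simp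
        add_le' := fun x y => by rw [map_add]; exact map_add_le_add p _ _
        neg' := fun x => by rw [map_neg]; exact map_neg_eq_map p _
        smul' := fun c x => by rw [map_smul]; exact map_smul_eq_mul p _ _
        mul_le' := fun x y => by rw [map_mul]; exact p.mul_le _ _
        star_mul_self' := fun x => by rw [map_mul, map_star]; exact p.star_mul_self _ } t

/-- The canonical map from the algebraic to the maximal tensor product. -/
def of (t : A ⊗[ℂ] C) : MaxTensor A C := CStarSeminorm.Completion.of (maxTensorNorm A C) t

/-- The `*`-homomorphism `φ ⊗ ρ : A ⊗_max C → B ⊗_max D`. -/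
def map (φ : A →⋆ₙₐ[ℂ] B) (ρ : C →⋆ₙₐ[ℂ] D) : MaxTensor A C →⋆ₙₐ[ℂ] MaxTensor B D :=
  CStarSeminorm.Completion.map (maxTensorNorm A C) (maxTensorNorm B D) (algMap φ ρ)
    (algMap_le φ ρ)

theorem map_of_tmul (φ : A →⋆ₙₐ[ℂ] B) (ρ : C →⋆ₙₐ[ℂ] D) (a : A) (c : C) :
    map φ ρ (of (a ⊗ₜ c)) = of (φ a ⊗ₜ ρ c) :=
  CStarSeminorm.Completion.map_of _ _ (algMap φ ρ) (algMap_le φ ρ) (a ⊗ₜ c)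

end MaxTensor


/-! ### The Cuntz semigroup -/

/-- The Hilbert space `ℓ²(ℕ)`. -/
abbrev HilbertSeq : Type := lp (fun _ : ℕ => ℂ) 2

/-- The compact operators on `ℓ²(ℕ)`, as a closed ideal of the bounded operators. -/
def compactOps : ClosedIdeal (HilbertSeq →L[ℂ] HilbertSeq) where
  carrier := {T | IsCompactOperator T}
  add_mem' ha hb := ha.add hb
  zero_mem' := isCompactOperator_zero
  smul_mem' c _ ha := ha.smul c
  mul_mem_left' a _ hj := hj.clm_comp a
  mul_mem_right' a hj := hj.comp_clm a
  isClosed' := isClosed_setOfPred_isCompactOperator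

/-- The C⋆-algebra `𝒦` of compact operators on `ℓ²(ℕ)`. -/
def CompactOp : Type := compactOps

instance : NonUnitalCStarAlgebra CompactOp := inferInstanceAs (NonUnitalCStarAlgebra compactOps)

/-- The stabilisation `A ⊗ 𝒦`. As `𝒦` is nuclear, there is only one C⋆-tensor product. -/
abbrev Stabilization (A : Type u) [NonUnitalCStarAlgebra A] : Type u := MaxTensor A CompactOp

section Cuntz

variable {A : Type u} {B : Type v} [NonUnitalCStarAlgebra A] [NonUnitalCStarAlgebra B]

/-- Cuntz subequivalence: `a ≾ b` if `v b v⋆` can be chosen arbitrarily close to `a`. -/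
def CuntzLE (a b : A) : Prop := ∀ ε : ℝ, 0 < ε → ∃ v : A, ‖v * b * star v - a‖ < ε

theorem CuntzLE.refl (a : A) : CuntzLE a a := by
  intro ε hε
  obtain ⟨l, hl, h1, h2, hs, hn, -⟩ :=
    exists_approx_unit (⊤ : NonUnitalStarSubalgebra ℂ A) isClosed_univ
  let a' : (⊤ : NonUnitalStarSubalgebra ℂ A) := ⟨a, trivial⟩
  have t1 := Metric.tendsto_nhds.1 (h1 a') (ε / 2) (half_pos hε)
  have t2 := Metric.tendsto_nhds.1 (h2 a') (ε / 2) (half_pos hε)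
  obtain ⟨e, he1, he2, hse, hne⟩ := (t1.and (t2.and (hs.and hn))).exists
  have he1' : ‖(e : A) * a - a‖ < ε / 2 := by simpa [dist_eq_norm] using he1
  have he2' : ‖a * (e : A) - a‖ < ε / 2 := by simpa [dist_eq_norm] using he2
  have hse' : star (e : A) = e := congrArg Subtype.val hse
  refine ⟨e, ?_⟩
  have e1 : (e : A) * a * star (e : A) - a =
      ((e : A) * a - a) * (e : A) + (a * (e : A) - a) := by
    rw [hse', sub_mul]; abel
  rw [e1]
  calc _ ≤ ‖(e : A) * a - a‖ * ‖(e : A)‖ + ‖a * (e : A) - a‖ :=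
        (norm_add_le _ _).trans (add_le_add_left (norm_mul_le _ _) _)
    _ < ε := by nlinarith [norm_nonneg ((e : A) * a - a)]

theorem CuntzLE.trans {a b c : A} (h₁ : CuntzLE a b) (h₂ : CuntzLE b c) : CuntzLE a c := by
  intro ε hε
  obtain ⟨v, hv⟩ := h₁ (ε / 2) (half_pos hε)
  obtain ⟨y, hy⟩ := h₂ (ε / 2 / (‖v‖ * ‖v‖ + 1)) (by positivity)
  refine ⟨v * y, ?_⟩
  have e : v * y * c * star (v * y) - a =
      v * (y * c * star y - b) * star v + (v * b * star v - a) := by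
    simp only [star_mul, mul_sub, sub_mul, mul_assoc]
    abel
  rw [e]
  have h3 : ‖v * (y * c * star y - b) * star v‖ ≤ ‖v‖ * ‖y * c * star y - b‖ * ‖v‖ := by
    refine (norm_mul_le _ _).trans ?_
    rw [norm_star]
    gcongr
    exact norm_mul_le _ _
  have h4 : ‖v‖ * ‖y * c * star y - b‖ * ‖v‖ ≤ ε / 2 := by
    rw [lt_div_iff₀ (by positivity)] at hy
    nlinarith [norm_nonneg (y * c * star y - b)]
  calc _ ≤ _ := norm_add_le _ _
    _ < ε := by linarith

variable (A) in
/-- The positive elements of `A ⊗ 𝒦`. -/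
def StablePos : Type u := {a : Stabilization A // IsPosElem a}

instance : Preorder (StablePos A) where
  le a b := CuntzLE a.1 b.1
  le_refl a := CuntzLE.refl a.1
  le_trans _ _ _ := CuntzLE.trans

variable (A) in
/-- The Cuntz semigroup `Cu(A)` as a partially ordered set: the positive elements of `A ⊗ 𝒦`
modulo Cuntz equivalence, ordered by Cuntz subequivalence. -/
abbrev Cu : Type u := Antisymmetrization (StablePos A) (· ≤ ·)

/-- The map on positive elements of the stabilisations given by `φ ⊗ id`. -/
def StablePos.map (φ : A →⋆ₙₐ[ℂ] B) : StablePos A →o StablePos B where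
  toFun a := ⟨MaxTensor.map φ (NonUnitalStarAlgHom.id ℂ CompactOp) a.1, by
    obtain ⟨y, hy⟩ := a.2
    exact ⟨MaxTensor.map φ (NonUnitalStarAlgHom.id ℂ CompactOp) y, by
      rw [hy, map_mul, map_star]⟩⟩
  monotone' a b h ε hε := by
    obtain ⟨v, hv⟩ := h ε hε
    refine ⟨MaxTensor.map φ (NonUnitalStarAlgHom.id ℂ CompactOp) v, ?_⟩
    rw [← map_star, ← map_mul, ← map_mul, ← map_sub]
    exact (NonUnitalStarAlgHom.norm_apply_le _ _).trans_lt hv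

/-- The map `Cu(φ) : Cu(A) → Cu(B)`, `⟨a⟩ ↦ ⟨(φ ⊗ id)(a)⟩`. -/
def Cu.map (φ : A →⋆ₙₐ[ℂ] B) : Cu A →o Cu B := (StablePos.map φ).antisymmetrization

end Cuntz

/-! ### K-theory -/

section KTheory

open Matrix

/-- Murray–von Neumann equivalence of projections in matrix algebras. -/
def MvN {R : Type u} [Ring R] [StarRing R] {ι κ : Type} [Fintype ι] [Fintype κ]
    (p : Matrix ι ι R) (q : Matrix κ κ R) : Prop :=
  ∃ v : Matrix ι κ R, v * vᴴ = p ∧ vᴴ * v = q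

variable (R : Type u) [Ring R] [StarRing R]

/-- Projections in matrices of arbitrary finite size over `R`. -/
structure ProjMat : Type u where
  size : ℕ
  mat : Matrix (Fin size) (Fin size) R
  isProj : IsStarProjection mat

variable {R}

section MvN

variable {ι κ μ ν : Type} [Fintype ι] [Fintype κ] [Fintype μ] [Fintype ν]

theorem MvN.refl {p : Matrix ι ι R} (hp : IsStarProjection p) : MvN p p :=
  have h : pᴴ = p := hp.isSelfAdjoint
  ⟨p, by rw [h]; exact hp.isIdempotentElem, by rw [h]; exact hp.isIdempotentElem⟩

theorem MvN.symm {p : Matrix ι ι R} {q : Matrix κ κ R} (h : MvN p q) : MvN q p := by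
  obtain ⟨v, h1, h2⟩ := h
  exact ⟨vᴴ, by rwa [conjTranspose_conjTranspose], by rwa [conjTranspose_conjTranspose]⟩

theorem MvN.trans {p : Matrix ι ι R} {q : Matrix κ κ R} {r : Matrix μ μ R}
    (hp : IsStarProjection p) (hr : IsStarProjection r)
    (h₁ : MvN p q) (h₂ : MvN q r) : MvN p r := by
  obtain ⟨v, h1, h2⟩ := h₁
  obtain ⟨y, h3, h4⟩ := h₂
  refine ⟨v * y, ?_, ?_⟩
  · calc v * y * (v * y)ᴴ = v * (y * yᴴ) * vᴴ := by
          rw [conjTranspose_mul]; simp only [Matrix.mul_assoc]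
      _ = (v * vᴴ) * (v * vᴴ) := by rw [h3, ← h2]; simp only [Matrix.mul_assoc]
      _ = p := by rw [h1]; exact hp.isIdempotentElem
  · calc (v * y)ᴴ * (v * y) = yᴴ * (vᴴ * v) * y := by
          rw [conjTranspose_mul]; simp only [Matrix.mul_assoc]
      _ = (yᴴ * y) * (yᴴ * y) := by rw [h2, ← h3]; simp only [Matrix.mul_assoc]
      _ = r := by rw [h4]; exact hr.isIdempotentElem

theorem MvN.reindex {p : Matrix ι ι R} (hp : IsStarProjection p) (e : ι ≃ κ) :
    MvN p (Matrix.reindex e e p) := by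
  have h : pᴴ = p := hp.isSelfAdjoint
  have h' : p * p = p := hp.isIdempotentElem
  refine ⟨p.submatrix id e.symm, ?_, ?_⟩
  · rw [conjTranspose_submatrix, h, Matrix.submatrix_mul_equiv, h', Matrix.submatrix_id_id]
  · rw [conjTranspose_submatrix, h]
    have := Matrix.submatrix_mul_equiv p p e.symm (Equiv.refl ι) e.symm
    rw [h'] at this
    exact this

theorem MvN.fromBlocks {p : Matrix ι ι R} {q : Matrix κ κ R} {p' : Matrix μ μ R}
    {q' : Matrix ν ν R} (h₁ : MvN p p') (h₂ : MvN q q') :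
    MvN (Matrix.fromBlocks p 0 0 q) (Matrix.fromBlocks p' 0 0 q') := by
  obtain ⟨v, h1, h2⟩ := h₁
  obtain ⟨y, h3, h4⟩ := h₂
  exact ⟨Matrix.fromBlocks v 0 0 y,
    by simp [fromBlocks_conjTranspose, fromBlocks_multiply, h1, h3],
    by simp [fromBlocks_conjTranspose, fromBlocks_multiply, h2, h4]⟩

theorem MvN.of_isEmpty [IsEmpty ι] [IsEmpty κ] (p : Matrix ι ι R) (q : Matrix κ κ R) : MvN p q :=
  ⟨0, Subsingleton.elim _ _, Subsingleton.elim _ _⟩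

theorem MvN.fromBlocks_empty [IsEmpty ι] {z : Matrix ι ι R} {q : Matrix κ κ R}
    (hs : IsStarProjection (Matrix.fromBlocks z 0 0 q)) :
    MvN (Matrix.fromBlocks z 0 0 q) q := by
  have := MvN.reindex hs (Equiv.emptySum ι κ)
  have e : Matrix.reindex (Equiv.emptySum ι κ) (Equiv.emptySum ι κ)
      (Matrix.fromBlocks z 0 0 q) = q := by
    ext i j; rfl
  rwa [e] at this

theorem MvN.map {S : Type v} [Ring S] [StarRing S] [Algebra ℂ R] [Algebra ℂ S] (f : R →⋆ₐ[ℂ] S)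
    {p : Matrix ι ι R} {q : Matrix κ κ R} (h : MvN p q) : MvN (p.map f) (q.map f) := by
  obtain ⟨y, rfl, rfl⟩ := h
  have h : (y.map f)ᴴ = yᴴ.map f := (Matrix.conjTranspose_map _ (map_star f)).symm
  exact ⟨y.map f, by rw [h, Matrix.map_mul], by rw [h, Matrix.map_mul]⟩

theorem IsStarProjection.fromBlocks {p : Matrix ι ι R} {q : Matrix κ κ R}
    (hp : IsStarProjection p) (hq : IsStarProjection q) :
    IsStarProjection (Matrix.fromBlocks p 0 0 q) := by
  have h1 : p * p = p := hp.isIdempotentElem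
  have h2 : q * q = q := hq.isIdempotentElem
  have h3 : pᴴ = p := hp.isSelfAdjoint
  have h4 : qᴴ = q := hq.isSelfAdjoint
  refine ⟨?_, ?_⟩
  · simp [IsIdempotentElem, fromBlocks_multiply, h1, h2]
  · simp [IsSelfAdjoint, star_eq_conjTranspose, fromBlocks_conjTranspose, h3, h4]

theorem IsStarProjection.reindex {p : Matrix ι ι R} (hp : IsStarProjection p) (e : ι ≃ κ) :
    IsStarProjection (Matrix.reindex e e p) := by
  have h1 : p * p = p := hp.isIdempotentElem
  have h3 : pᴴ = p := hp.isSelfAdjoint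
  refine ⟨?_, ?_⟩
  · simp [IsIdempotentElem, Matrix.submatrix_mul_equiv, h1]
  · simp [IsSelfAdjoint, star_eq_conjTranspose, h3]

end MvN

theorem map_reindex_fromBlocks {S : Type v} {ι κ μ : Type} [Ring S] [StarRing S] [Algebra ℂ R] [Algebra ℂ S]
    (f : R →⋆ₐ[ℂ] S) (p : Matrix ι ι R) (q : Matrix κ κ R) (e : ι ⊕ κ ≃ μ) :
    (Matrix.reindex e e (Matrix.fromBlocks p 0 0 q)).map f =
      Matrix.reindex e e (Matrix.fromBlocks (p.map f) 0 0 (q.map f)) := by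
  rw [Matrix.reindex_apply, Matrix.reindex_apply, ← Matrix.submatrix_map,
    Matrix.fromBlocks_map, Matrix.map_zero _ (map_zero f), Matrix.map_zero _ (map_zero f)]

instance ProjMat.setoid : Setoid (ProjMat R) where
  r p q := MvN p.mat q.mat
  iseqv := ⟨fun p => MvN.refl p.isProj, MvN.symm, fun {p _ r} => MvN.trans p.isProj r.isProj⟩

/-- The orthogonal sum `p ⊕ q = diag(p, q)`. -/
def ProjMat.add (p q : ProjMat R) : ProjMat R :=
  ⟨p.size + q.size, Matrix.reindex finSumFinEquiv finSumFinEquiv (Matrix.fromBlocks p.mat 0 0 q.mat),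
    (p.isProj.fromBlocks q.isProj).reindex _⟩

theorem ProjMat.mvN_add (p q : ProjMat R) :
    MvN (Matrix.fromBlocks p.mat 0 0 q.mat) (p.add q).mat :=
  MvN.reindex (p.isProj.fromBlocks q.isProj) _

/-- The projection in the algebra of `0 × 0` matrices. -/
def ProjMat.zero : ProjMat R := ⟨0, 0, IsStarProjection.zero _⟩

variable (R) in
/-- The Murray–von Neumann semigroup `V(R)`: equivalence classes of projections in matrices
over `R`. -/
def MvNSemigroup : Type u := Quotient (ProjMat.setoid (R := R))

namespace MvNSemigroup

instance : Add (MvNSemigroup R) where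
  add := Quotient.map₂ ProjMat.add fun p p' hp q q' hq =>
    ((p.mvN_add q).symm.trans (p.add q).isProj (p'.isProj.fromBlocks q'.isProj)
      (MvN.fromBlocks hp hq)).trans (p.add q).isProj (p'.add q').isProj (p'.mvN_add q')

instance : Zero (MvNSemigroup R) where
  zero := Quotient.mk _ ProjMat.zero

theorem add_comm' (a b : MvNSemigroup R) : a + b = b + a := by
  induction a using Quotient.inductionOn with | _ p
  induction b using Quotient.inductionOn with | _ q
  refine Quotient.sound ?_
  have h : MvN (Matrix.fromBlocks p.mat 0 0 q.mat) (Matrix.fromBlocks q.mat 0 0 p.mat) := by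
    have := MvN.reindex (p.isProj.fromBlocks q.isProj) (Equiv.sumComm _ _)
    simpa [Matrix.reindex_apply] using this
  exact ((p.mvN_add q).symm.trans (p.add q).isProj (q.isProj.fromBlocks p.isProj) h).trans
    (p.add q).isProj (q.add p).isProj (q.mvN_add p)

theorem zero_add' (a : MvNSemigroup R) : 0 + a = a := by
  induction a using Quotient.inductionOn with | _ q
  refine Quotient.sound ?_
  have h : MvN (Matrix.fromBlocks (ProjMat.zero (R := R)).mat 0 0 q.mat) q.mat :=
    MvN.fromBlocks_empty (ι := Fin 0) ((ProjMat.zero (R := R)).isProj.fromBlocks q.isProj)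
  exact ((ProjMat.zero.mvN_add q).symm.trans (ProjMat.zero.add q).isProj q.isProj h)

theorem add_assoc' (a b c : MvNSemigroup R) : a + b + c = a + (b + c) := by
  induction a using Quotient.inductionOn with | _ p
  induction b using Quotient.inductionOn with | _ q
  induction c using Quotient.inductionOn with | _ r
  refine Quotient.sound ?_
  have h : MvN (Matrix.fromBlocks (Matrix.fromBlocks p.mat 0 0 q.mat) 0 0 r.mat)
      (Matrix.fromBlocks p.mat 0 0 (Matrix.fromBlocks q.mat 0 0 r.mat)) := by
    have := MvN.reindex ((p.isProj.fromBlocks q.isProj).fromBlocks r.isProj) (Equiv.sumAssoc _ _ _)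
    convert this using 1
    ext i j
    rcases i with i | i | i <;> rcases j with j | j | j <;> rfl
  have h1 : MvN ((p.add q).add r).mat
      (Matrix.fromBlocks (Matrix.fromBlocks p.mat 0 0 q.mat) 0 0 r.mat) :=
    ((p.add q).mvN_add r).symm.trans ((p.add q).add r).isProj
      ((p.isProj.fromBlocks q.isProj).fromBlocks r.isProj)
      (MvN.fromBlocks (p.mvN_add q).symm (MvN.refl r.isProj))
  have h2 : MvN (Matrix.fromBlocks p.mat 0 0 (Matrix.fromBlocks q.mat 0 0 r.mat))
      (p.add (q.add r)).mat :=
    (MvN.fromBlocks (MvN.refl p.isProj) (q.mvN_add r)).trans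
      (p.isProj.fromBlocks (q.isProj.fromBlocks r.isProj)) (p.add (q.add r)).isProj (p.mvN_add (q.add r))
  exact (h1.trans ((p.add q).add r).isProj (p.isProj.fromBlocks (q.isProj.fromBlocks r.isProj)) h).trans
    ((p.add q).add r).isProj (p.add (q.add r)).isProj h2

instance : AddCommMonoid (MvNSemigroup R) where
  add_assoc := add_assoc'
  zero_add := zero_add'
  add_zero a := by rw [add_comm', zero_add']
  add_comm := add_comm'
  nsmul := nsmulRec

end MvNSemigroup

section Functoriality

variable {S : Type v} [Ring S] [StarRing S] [Algebra ℂ R] [Algebra ℂ S]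

/-- Entrywise application of a `*`-homomorphism to a projection. -/
def ProjMat.map (f : R →⋆ₐ[ℂ] S) (p : ProjMat R) : ProjMat S :=
  ⟨p.size, p.mat.map f, by
    have h1 : p.mat * p.mat = p.mat := p.isProj.isIdempotentElem
    have h2 : p.matᴴ = p.mat := p.isProj.isSelfAdjoint
    refine ⟨?_, ?_⟩
    · rw [IsIdempotentElem, ← Matrix.map_mul, h1]
    · rw [IsSelfAdjoint, star_eq_conjTranspose, ← Matrix.conjTranspose_map _ (map_star f), h2]⟩

/-- The additive map `V(R) → V(S)` induced by a `*`-homomorphism. -/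
def MvNSemigroup.map (f : R →⋆ₐ[ℂ] S) : MvNSemigroup R →+ MvNSemigroup S where
  toFun := Quotient.map (ProjMat.map f) fun _ _ h => MvN.map f h
  map_zero' := Quotient.sound (MvN.of_isEmpty (ι := Fin 0) (κ := Fin 0) _ _)
  map_add' a b := by
    induction a using Quotient.inductionOn with | _ p
    induction b using Quotient.inductionOn with | _ q
    refine Quotient.sound ?_
    have h : (ProjMat.map f (p.add q)).mat = ((p.map f).add (q.map f)).mat :=
      map_reindex_fromBlocks f p.mat q.mat finSumFinEquiv
    exact Eq.subst (motive := fun m => MvN (ProjMat.map f (p.add q)).mat m) h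
      (MvN.refl (ProjMat.map f (p.add q)).isProj)

end Functoriality

/-- `K₀` of a unital C⋆-algebra: the Grothendieck group of the Murray–von Neumann semigroup. -/
abbrev UnitalK0 (R : Type u) [CStarAlgebra R] : Type u :=
  Algebra.GrothendieckAddGroup (MvNSemigroup R)

/-- The group homomorphism `K₀(f)` for a unital `*`-homomorphism `f`. -/
def UnitalK0.map {R : Type u} {S : Type v} [CStarAlgebra R] [CStarAlgebra S] (f : R →⋆ₐ[ℂ] S) :
    UnitalK0 R →+ UnitalK0 S :=
  Algebra.GrothendieckAddGroup.lift
    ((Algebra.GrothendieckAddGroup.of (M := MvNSemigroup S)).comp (MvNSemigroup.map f))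

theorem UnitalK0.map_of {R : Type u} {S : Type v} [CStarAlgebra R] [CStarAlgebra S]
    (f : R →⋆ₐ[ℂ] S) (a : MvNSemigroup R) :
    UnitalK0.map f (Algebra.GrothendieckAddGroup.of a) =
      Algebra.GrothendieckAddGroup.of (MvNSemigroup.map f a) :=
  DFunLike.congr_fun (Algebra.GrothendieckAddGroup.lift.symm_apply_apply
    ((Algebra.GrothendieckAddGroup.of (M := MvNSemigroup S)).comp (MvNSemigroup.map f))) a

theorem UnitalK0.map_comp {R : Type u} {S : Type v} {Q : Type w} [CStarAlgebra R]
    [CStarAlgebra S] [CStarAlgebra Q] (g : S →⋆ₐ[ℂ] Q) (f : R →⋆ₐ[ℂ] S) :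
    UnitalK0.map (g.comp f) = (UnitalK0.map g).comp (UnitalK0.map f) := by
  apply Algebra.GrothendieckAddGroup.lift.symm.injective
  ext a
  have h : MvNSemigroup.map (g.comp f) a = MvNSemigroup.map g (MvNSemigroup.map f a) := by
    induction a using Quotient.inductionOn with | _ p
    rfl
  change UnitalK0.map (g.comp f) (Algebra.GrothendieckAddGroup.of a) =
    UnitalK0.map g (UnitalK0.map f (Algebra.GrothendieckAddGroup.of a))
  rw [UnitalK0.map_of, UnitalK0.map_of, UnitalK0.map_of, h]

end KTheory

section NonUnitalKTheory

variable {A : Type u} {B : Type v} [NonUnitalCStarAlgebra A] [NonUnitalCStarAlgebra B]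

variable (A) in
/-- The canonical character `A~ → ℂ` of the unitization. -/
def unitizationChar : Unitization ℂ A →⋆ₐ[ℂ] ℂ :=
  { Unitization.fstHom ℂ A with map_star' := fun _ => rfl }

variable (A) in
/-- `K₀(A)`: the kernel of `K₀(A~) → K₀(ℂ)`, where `A~` is the unitization. -/
def K0 : Type u := (UnitalK0.map (unitizationChar A)).ker

instance : AddCommGroup (K0 A) :=
  inferInstanceAs (AddCommGroup (UnitalK0.map (unitizationChar A)).ker)

/-- The group homomorphism `K₀(φ)`: the restriction of `K₀(φ~)`. -/
def K0.map (φ : A →⋆ₙₐ[ℂ] B) : K0 A →+ K0 B :=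
  ((UnitalK0.map (Unitization.starMap φ)).comp
    (UnitalK0.map (unitizationChar A)).ker.subtype).codRestrict
    (UnitalK0.map (unitizationChar B)).ker (by
      rintro ⟨y, hy⟩
      have h : (unitizationChar B).comp (Unitization.starMap φ) = unitizationChar A := by
        ext a
        simp [unitizationChar]
        rfl
      rw [AddMonoidHom.mem_ker] at hy ⊢
      rw [← h, UnitalK0.map_comp] at hy
      exact hy)

open scoped ZeroAtInfty in
variable (A) in
/-- The suspension `C₀(ℝ) ⊗ A`. As `C₀(ℝ)` is nuclear, there is only one C⋆-tensor product. -/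
abbrev Suspension : Type u := MaxTensor C₀(ℝ, ℂ) A

variable (A) in
/-- `K₁(A) = K₀(C₀(ℝ) ⊗ A)`. -/
abbrev K1 : Type u := K0 (Suspension A)

/-- The group homomorphism `K₁(φ)`. -/
def K1.map (φ : A →⋆ₙₐ[ℂ] B) : K1 A →+ K1 B :=
  K0.map (MaxTensor.map (NonUnitalStarAlgHom.id ℂ _) φ)

/-- The algebra `C₀(Wₙ)` of continuous functions on the Moore space of `ℤ/n` that vanish at the
base point. The Moore space is the closed unit disk with points `z, w` on the boundary
identified if `zⁿ = wⁿ`, and the base point is the class of `1`. Its `K`-theory is `K₀ = ℤ/n` and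
`K₁ = 0`. -/
def mooreAlgebra (n : ℕ) : NonUnitalStarSubalgebra ℂ C(Metric.closedBall (0 : ℂ) 1, ℂ) where
  carrier := {f | (∀ z y : Metric.closedBall (0 : ℂ) 1, ‖(z : ℂ)‖ = 1 → ‖(y : ℂ)‖ = 1 →
    (z : ℂ) ^ n = (y : ℂ) ^ n → f z = f y) ∧ ∀ z : Metric.closedBall (0 : ℂ) 1, (z : ℂ) = 1 → f z = 0}
  add_mem' {f g} hf hg := ⟨fun z y hz hy h => by
    simp [hf.1 z y hz hy h, hg.1 z y hz hy h], fun z hz => by simp [hf.2 z hz, hg.2 z hz]⟩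
  zero_mem' := ⟨fun _ _ _ _ _ => rfl, fun _ _ => rfl⟩
  mul_mem' {f g} hf hg := ⟨fun z y hz hy h => by
    simp [hf.1 z y hz hy h, hg.1 z y hz hy h], fun z hz => by simp [hf.2 z hz]⟩
  smul_mem' c f hf := ⟨fun z y hz hy h => by
    simp [hf.1 z y hz hy h], fun z hz => by simp [hf.2 z hz]⟩
  star_mem' {f} hf := ⟨fun z y hz hy h => by
    simp [hf.1 z y hz hy h], fun z hz => by simp [hf.2 z hz]⟩

instance isClosed_mooreAlgebra (n : ℕ) :
    IsClosed (mooreAlgebra n : Set C(Metric.closedBall (0 : ℂ) 1, ℂ)) := by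
  have : (mooreAlgebra n : Set C(Metric.closedBall (0 : ℂ) 1, ℂ)) =
      (⋂ (z : Metric.closedBall (0 : ℂ) 1) (y : Metric.closedBall (0 : ℂ) 1)
        (_ : ‖(z : ℂ)‖ = 1) (_ : ‖(y : ℂ)‖ = 1) (_ : (z : ℂ) ^ n = (y : ℂ) ^ n),
        {f : C(Metric.closedBall (0 : ℂ) 1, ℂ) | f z = f y}) ∩
      ⋂ (z : Metric.closedBall (0 : ℂ) 1) (_ : (z : ℂ) = 1), {f | f z = 0} := by
    ext f
    simp only [Set.mem_inter_iff, Set.mem_iInter, Set.mem_ofPred_eq]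
    exact Iff.rfl
  rw [this]
  refine IsClosed.inter ?_ ?_
  · exact isClosed_iInter fun z => isClosed_iInter fun y => isClosed_iInter fun _ =>
      isClosed_iInter fun _ => isClosed_iInter fun _ =>
        isClosed_eq (continuous_eval_const z) (continuous_eval_const y)
  · exact isClosed_iInter fun z => isClosed_iInter fun _ =>
      isClosed_eq (continuous_eval_const z) continuous_const

variable (A) in
/-- `K₀(A; ℤ/n) = K₀(A ⊗ C₀(Wₙ))`. As `C₀(Wₙ)` is nuclear, there is only one C⋆-tensor product. -/
abbrev K0Mod (n : ℕ) : Type u := K0 (MaxTensor A (mooreAlgebra n))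

variable (A) in
/-- `K₁(A; ℤ/n) = K₁(A ⊗ C₀(Wₙ))`. -/
abbrev K1Mod (n : ℕ) : Type u := K1 (MaxTensor A (mooreAlgebra n))

/-- The map induced by `φ` on `K₀` with coefficients in `ℤ/n`. -/
def K0Mod.map (n : ℕ) (φ : A →⋆ₙₐ[ℂ] B) : K0Mod A n →+ K0Mod B n :=
  K0.map (MaxTensor.map φ (NonUnitalStarAlgHom.id ℂ (mooreAlgebra n)))

/-- The map induced by `φ` on `K₁` with coefficients in `ℤ/n`. -/
def K1Mod.map (n : ℕ) (φ : A →⋆ₙₐ[ℂ] B) : K1Mod A n →+ K1Mod B n :=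
  K1.map (MaxTensor.map φ (NonUnitalStarAlgHom.id ℂ (mooreAlgebra n)))

end NonUnitalKTheory

/-! ### Tracial states -/

/-- A tracial state: a positive linear functional of norm one with `τ(ab) = τ(ba)`. -/
structure TracialState (A : Type u) [NonUnitalCStarAlgebra A] where
  toFun : A →L[ℂ] ℂ
  nonneg' : ∀ a : A, 0 ≤ (toFun (star a * a)).re ∧ (toFun (star a * a)).im = 0
  norm_eq_one' : ‖toFun‖ = 1
  trace' : ∀ a b : A, toFun (a * b) = toFun (b * a)

instance (A : Type u) [NonUnitalCStarAlgebra A] : CoeFun (TracialState A) (fun _ => A → ℂ) where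
  coe τ := τ.toFun

end

/-!
Let `ψ : B → A_∞` be a splitting of `φ`. Products such as `φ e * b * φ e'` with `e`, `e'` in a
hereditary subalgebra or an ideal are sent by `ψ` to classes of sequences in that subalgebra, so `ψ`
restricts, and for an ideal also descends to the quotients. Splittings `ψ` and `σ` of `φ` and `ρ`
give the splitting of `φ ⊗ ρ` through the canonical map `A_∞ ⊗_max C_∞ → (A ⊗_max C)_∞`.

The remaining invariants are governed by approximate relations, and these pass from `A_∞` to `A`
by choosing a late enough entry of a representing sequence. For Cuntz comparison this is immediate.
In K-theory, `ψ` turns a partial isometry between projections `φ p` and `φ q` into a matrix over `A`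
that is almost a partial isometry between `p` and `q`, and its polar part is an exact one. For
traces, one composes `ψ` with the limit of `τ` along a free ultrafilter.
-/

noncomputable section

open Filter Topology
open scoped CStarAlgebra ENNReal TensorProduct lp

/-! ### The sequence algebra -/

section Factorization

variable {R A B C : Type*} [CommSemiring R]
  [NonUnitalSemiring A] [Module R A] [Star A] [NonUnitalSemiring B] [Module R B] [Star B]
  [NonUnitalSemiring C] [Module R C] [Star C]

/-- The factorization `C → A` through an injective `*`-homomorphism `i : A → B` of a
`*`-homomorphism `C → B` with values in the range of `i`. -/
def factorThrough (i : A →⋆ₙₐ[R] B) (hi : Function.Injective i) (f : C →⋆ₙₐ[R] B)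
    (hf : ∀ c, f c ∈ NonUnitalStarAlgHom.range i) : C →⋆ₙₐ[R] A :=
  ((StarAlgEquiv.ofInjective' i hi).symm : NonUnitalStarAlgHom.range i →⋆ₙₐ[R] A).comp
    (NonUnitalStarAlgHom.codRestrict f (NonUnitalStarAlgHom.range i) hf)

theorem apply_factorThrough (i : A →⋆ₙₐ[R] B) (hi : Function.Injective i) (f : C →⋆ₙₐ[R] B)
    (hf : ∀ c, f c ∈ NonUnitalStarAlgHom.range i) (c : C) :
    i (factorThrough i hi f hf c) = f c :=
  congrArg Subtype.val ((StarAlgEquiv.ofInjective' i hi).apply_symm_apply ⟨f c, hf c⟩)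

end Factorization

theorem isClosed_range_of_injective {A B : Type*} [NonUnitalCStarAlgebra A]
    [NonUnitalCStarAlgebra B] (i : A →⋆ₙₐ[ℂ] B) (hi : Function.Injective i) :
    IsClosed (NonUnitalStarAlgHom.range i : Set B) := by
  rw [NonUnitalStarAlgHom.coe_range]
  exact (NonUnitalStarAlgHom.isometry i hi).isClosedEmbedding.isClosed_range

namespace ClosedIdeal

variable {A B : Type*} [NonUnitalCStarAlgebra A] [NonUnitalCStarAlgebra B]

namespace Quotient

theorem mk_surjective (J : ClosedIdeal A) : Function.Surjective (mk J) :=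
  of_surjective J

theorem mk_eq_zero (J : ClosedIdeal A) {a : A} : mk J a = 0 ↔ a ∈ J :=
  Submodule.Quotient.mk_eq_zero J.toSubmodule

/-- The `*`-homomorphism `A / J → B` induced by a `*`-homomorphism `A → B` that vanishes on `J`. -/
def lift (J : ClosedIdeal A) (f : A →⋆ₙₐ[ℂ] B) (h : ∀ a ∈ J, f a = 0) : J.Quotient →⋆ₙₐ[ℂ] B :=
  { J.toSubmodule.liftQ (f : A →ₗ[ℂ] B) h with
    map_zero' := map_zero f
    map_mul' := (mk_surjective J).forall₂.2 (map_mul f)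
    map_star' := (mk_surjective J).forall.2 (map_star f) }

theorem lift_mk (J : ClosedIdeal A) (f : A →⋆ₙₐ[ℂ] B) (h : ∀ a ∈ J, f a = 0) (a : A) :
    lift J f h (mk J a) = f a := rfl

end Quotient

/-- The inclusion of a closed ideal. -/
abbrev subtype (J : ClosedIdeal A) : J →⋆ₙₐ[ℂ] A := NonUnitalStarSubalgebraClass.subtype J

end ClosedIdeal

section SeqAlgMap

variable {A B : Type*} [NonUnitalCStarAlgebra A] [NonUnitalCStarAlgebra B]

/-- The sequence `a` as an element of `ℓ^∞(ℕ, A)`, given a bound on its norms. -/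
def boundedSeq (a : ℕ → A) (M : ℝ) (h : ∀ n, ‖a n‖ ≤ M) : ℓ^∞(ℕ, A) :=
  ⟨a, memℓp_infty ⟨M, by rintro _ ⟨n, rfl⟩; exact h n⟩⟩

theorem norm_entry_le (a : ℓ^∞(ℕ, A)) (n : ℕ) : ‖a n‖ ≤ ‖a‖ :=
  lp.norm_apply_le_norm ENNReal.top_ne_zero a n

/-- Entrywise application of a `*`-homomorphism to bounded sequences. -/
def boundedSeqMap (f : A →⋆ₙₐ[ℂ] B) : ℓ^∞(ℕ, A) →⋆ₙₐ[ℂ] ℓ^∞(ℕ, B) where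
  toFun a := boundedSeq (fun n => f (a n)) ‖a‖ fun n =>
    (NonUnitalStarAlgHom.norm_apply_le f _).trans (norm_entry_le a n)
  map_smul' c a := by ext n; exact map_smul f c (a n)
  map_zero' := lp.ext (funext fun _ => map_zero f)
  map_add' a b := by ext n; exact map_add f (a n) (b n)
  map_mul' a b := by ext n; exact map_mul f (a n) (b n)
  map_star' a := by ext n; exact map_star f (a n)

namespace SeqAlg

variable (A) in
/-- The class in `A_∞` of a bounded sequence. -/
abbrev mk : ℓ^∞(ℕ, A) →⋆ₙₐ[ℂ] SeqAlg A := ClosedIdeal.Quotient.mk (nullSequences A)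

variable (A) in
theorem mk_surjective : Function.Surjective (mk A) := ClosedIdeal.Quotient.mk_surjective _

theorem mk_eq_zero {a : ℓ^∞(ℕ, A)} : mk A a = 0 ↔ Tendsto (fun n => ‖a n‖) atTop (𝓝 0) :=
  ClosedIdeal.Quotient.mk_eq_zero _

theorem mk_eq_mk {a b : ℓ^∞(ℕ, A)} :
    mk A a = mk A b ↔ Tendsto (fun n => ‖a n - b n‖) atTop (𝓝 0) := by
  rw [← sub_eq_zero, ← map_sub, mk_eq_zero]
  rfl

theorem mk_constSeq (a : A) : mk A (constSeq a) = seqIncl A a := rfl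

theorem mk_eq_seqIncl {a : ℓ^∞(ℕ, A)} {b : A} :
    mk A a = seqIncl A b ↔ Tendsto a atTop (𝓝 b) :=
  mk_eq_mk.trans tendsto_iff_norm_sub_tendsto_zero.symm

theorem eventually_norm_lt {a : ℓ^∞(ℕ, A)} {ε : ℝ} (h : ‖mk A a‖ < ε) :
    ∀ᶠ n in atTop, ‖a n‖ < ε := by
  obtain ⟨b, hb, hbn⟩ := ClosedIdeal.Quotient.exists_norm_lt (nullSequences A) (mk A a)
    (half_pos (sub_pos.2 h))
  have hba : Tendsto (fun n => ‖b n - a n‖) atTop (𝓝 0) := mk_eq_mk.1 hb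
  filter_upwards [hba.eventually_lt_const (half_pos (sub_pos.2 h))] with n hn
  have h₁ := norm_entry_le b n
  have h₂ := norm_le_norm_add_norm_sub (b n) (a n)
  linarith

/-- The `*`-homomorphism `A_∞ → B_∞` induced by a `*`-homomorphism `A → B`. -/
def map (f : A →⋆ₙₐ[ℂ] B) : SeqAlg A →⋆ₙₐ[ℂ] SeqAlg B :=
  ClosedIdeal.Quotient.map (boundedSeqMap f) (nullSequences A) (nullSequences B) fun a ha =>
    squeeze_zero (fun _ => norm_nonneg _) (fun n => NonUnitalStarAlgHom.norm_apply_le f (a n)) ha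

theorem map_mk (f : A →⋆ₙₐ[ℂ] B) (a : ℓ^∞(ℕ, A)) : map f (mk A a) = mk B (boundedSeqMap f a) :=
  rfl

theorem map_seqIncl (f : A →⋆ₙₐ[ℂ] B) (a : A) : map f (seqIncl A a) = seqIncl B (f a) := rfl

theorem map_injective {f : A →⋆ₙₐ[ℂ] B} (hf : Function.Injective f) :
    Function.Injective (map f) := by
  refine (injective_iff_map_eq_zero _).2 <| (mk_surjective A).forall.2 fun a ha => ?_
  rw [map_mk, mk_eq_zero] at ha
  exact mk_eq_zero.2 (ha.congr fun n => NonUnitalStarAlgHom.norm_map f hf (a n))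

theorem mk_mem_range_map {i : A →⋆ₙₐ[ℂ] B} (hi : Function.Injective i) {b : ℓ^∞(ℕ, B)}
    (hb : ∀ n, b n ∈ NonUnitalStarAlgHom.range i) :
    mk B b ∈ NonUnitalStarAlgHom.range (map i) := by
  choose a ha using hb
  have hle (n : ℕ) : ‖a n‖ ≤ ‖b‖ := by
    rw [← NonUnitalStarAlgHom.norm_map i hi]
    exact (ha n).symm ▸ norm_entry_le b n
  refine ⟨mk A (boundedSeq a ‖b‖ hle), congrArg (mk B) ?_⟩
  ext n
  exact ha n

theorem mem_range_of_seqIncl_mem_range_map {i : A →⋆ₙₐ[ℂ] B} (hi : Function.Injective i) {b : B}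
    (hb : seqIncl B b ∈ NonUnitalStarAlgHom.range (map i)) : b ∈ NonUnitalStarAlgHom.range i := by
  obtain ⟨q, hq⟩ := hb
  obtain ⟨a, rfl⟩ := mk_surjective A q
  exact (isClosed_range_of_injective i hi).mem_of_tendsto (mk_eq_seqIncl.1 hq)
    (Eventually.of_forall fun n => ⟨a n, rfl⟩)

end SeqAlg

theorem seqSplit_iff {φ : A →⋆ₙₐ[ℂ] B} :
    SeqSplit φ ↔ ∃ ψ : B →⋆ₙₐ[ℂ] SeqAlg A, ∀ a, ψ (φ a) = seqIncl A a :=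
  exists_congr fun _ => DFunLike.ext_iff

end SeqAlgMap

/-! ### Hereditary subalgebras and ideals -/

section Restrictions

variable {A B C E F : Type*} [NonUnitalCStarAlgebra A] [NonUnitalCStarAlgebra B]
  [NonUnitalCStarAlgebra C] [NonUnitalCStarAlgebra E] [NonUnitalCStarAlgebra F]

theorem apply_mem_of_mem_topologicalClosure_span (ψ : B →⋆ₙₐ[ℂ] C)
    {S : NonUnitalStarSubalgebra ℂ C} (hS : IsClosed (S : Set C)) {s : Set B}
    (hs : ∀ y ∈ s, ψ y ∈ S) {y : B} (hy : y ∈ (Submodule.span ℂ s).topologicalClosure) :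
    ψ y ∈ S :=
  Submodule.topologicalClosure_minimal (t := (S.comap ψ).toSubmodule) _ (Submodule.span_le.2 hs)
    (hS.preimage (map_continuous ψ)) hy

/-- The commuting square with sides `i`, `φ`, `f`, `j` exhibits `f` as a restriction of `φ`; it
inherits a splitting as soon as `ψ` maps `F` into `E_∞`. -/
theorem SeqSplit.of_apply_mem_range {φ : A →⋆ₙₐ[ℂ] B} {ψ : B →⋆ₙₐ[ℂ] SeqAlg A}
    (hψ : ∀ a, ψ (φ a) = seqIncl A a) {i : E →⋆ₙₐ[ℂ] A} (hi : Function.Injective i)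
    (j : F →⋆ₙₐ[ℂ] B) {f : E →⋆ₙₐ[ℂ] F} (hf : ∀ e, j (f e) = φ (i e))
    (hj : ∀ y, ψ (j y) ∈ NonUnitalStarAlgHom.range (SeqAlg.map i)) : SeqSplit f := by
  refine seqSplit_iff.2 ⟨factorThrough (SeqAlg.map i) (SeqAlg.map_injective hi) (ψ.comp j) hj,
    fun e => SeqAlg.map_injective hi ?_⟩
  calc SeqAlg.map i (factorThrough _ _ (ψ.comp j) hj (f e))
    _ = ψ (j (f e)) := apply_factorThrough _ _ _ _ _
    _ = SeqAlg.map i (seqIncl E e) := by rw [hf, hψ, SeqAlg.map_seqIncl]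

theorem isPosElem_iff_nonneg [PartialOrder A] [StarOrderedRing A] {a : A} : IsPosElem a ↔ 0 ≤ a :=
  CStarAlgebra.nonneg_iff_eq_star_mul_self.symm

theorem star_mul_mul_polarization {R : Type*} [NonUnitalRing R] [StarRing R] [Module ℂ R]
    [IsScalarTower ℂ R R] [SMulCommClass ℂ R R] [StarModule ℂ R] (e a f : R) :
    (4 : ℂ) • (star e * a * f) =
      star (e + f) * a * (e + f) - star (e - f) * a * (e - f)
      + Complex.I • (star (e - Complex.I • f) * a * (e - Complex.I • f))
      - Complex.I • (star (e + Complex.I • f) * a * (e + Complex.I • f)) := by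
  simp only [star_add, star_sub, star_smul, add_mul, mul_add, sub_mul, mul_sub, smul_add, smul_sub,
    smul_mul_assoc, mul_smul_comm, smul_smul, Complex.star_def, Complex.conj_I]
  simp only [mul_neg, Complex.I_mul_I, neg_smul, neg_neg, one_smul]
  module

namespace IsHereditary

variable {S : NonUnitalStarSubalgebra ℂ A}

theorem star_mul_mul_self_mem [PartialOrder A] [StarOrderedRing A] (hS : IsHereditary S)
    {a e : A} (ha : 0 ≤ a) (he : e ∈ S) : star e * a * e ∈ S := by
  refine hS ((‖a‖ : ℂ) • (star e * e)) (SMulMemClass.smul_mem _ (mul_mem (star_mem he) he)) _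
    (isPosElem_iff_nonneg.2 (star_left_conjugate_nonneg ha e)) (isPosElem_iff_nonneg.2 ?_)
  rw [sub_nonneg, Complex.coe_smul]
  exact CStarAlgebra.star_left_conjugate_le_norm_smul (IsSelfAdjoint.of_nonneg ha)

theorem star_mul_mul_mem_of_nonneg [PartialOrder A] [StarOrderedRing A] (hS : IsHereditary S)
    {a e f : A} (ha : 0 ≤ a) (he : e ∈ S) (hf : f ∈ S) : star e * a * f ∈ S := by
  have hIf : Complex.I • f ∈ S := SMulMemClass.smul_mem _ hf
  have h4 : (4 : ℂ) • (star e * a * f) ∈ S := by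
    rw [star_mul_mul_polarization]
    exact sub_mem (add_mem (sub_mem (hS.star_mul_mul_self_mem ha (add_mem he hf))
      (hS.star_mul_mul_self_mem ha (sub_mem he hf)))
      (SMulMemClass.smul_mem _ (hS.star_mul_mul_self_mem ha (sub_mem he hIf))))
      (SMulMemClass.smul_mem _ (hS.star_mul_mul_self_mem ha (add_mem he hIf)))
  simpa using SMulMemClass.smul_mem (4 : ℂ)⁻¹ h4

theorem mul_mul_mem (hS : IsHereditary S) {e f : A} (he : e ∈ S) (a : A) (hf : f ∈ S) :
    e * a * f ∈ S := by
  let _ : PartialOrder A := CStarAlgebra.spectralOrder A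
  have : StarOrderedRing A := CStarAlgebra.spectralOrderedRing A
  have ha : a ∈ Submodule.span ℂ {a : A | 0 ≤ a} := by
    rw [CStarAlgebra.span_nonneg]; exact Submodule.mem_top
  induction ha using Submodule.span_induction with
  | mem a ha => simpa using hS.star_mul_mul_mem_of_nonneg ha (star_mem he) hf
  | zero => simp
  | add x y _ _ hx hy => simpa only [mul_add, add_mul] using add_mem hx hy
  | smul r x _ hx =>
    simpa only [mul_smul_comm, smul_mul_assoc] using SMulMemClass.smul_mem r hx

end IsHereditary

theorem SeqSplit.hereditaryRestrict {φ : A →⋆ₙₐ[ℂ] B} (hφ : SeqSplit φ)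
    (S : NonUnitalStarSubalgebra ℂ A) [IsClosed (S : Set A)] (hS : IsHereditary S) :
    SeqSplit (hereditaryRestrict φ S) := by
  obtain ⟨ψ, hψ⟩ := seqSplit_iff.1 hφ
  have hi : Function.Injective (NonUnitalStarSubalgebraClass.subtype S) := Subtype.val_injective
  refine SeqSplit.of_apply_mem_range hψ hi
    (NonUnitalStarSubalgebraClass.subtype (hereditaryImage φ S)) (fun _ => rfl) fun y =>
    apply_mem_of_mem_topologicalClosure_span ψ
      (isClosed_range_of_injective _ (SeqAlg.map_injective hi)) ?_ y.2
  rintro _ ⟨e, he, b, e', he', rfl⟩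
  obtain ⟨a, ha⟩ := SeqAlg.mk_surjective A (ψ b)
  rw [map_mul, map_mul, hψ, hψ, ← ha]
  exact SeqAlg.mk_mem_range_map hi (b := constSeq e * a * constSeq e')
    fun n => ⟨⟨e * a n * e', hS.mul_mul_mem he (a n) he'⟩, rfl⟩

variable {φ : A →⋆ₙₐ[ℂ] B} {ψ : B →⋆ₙₐ[ℂ] SeqAlg A}

theorem apply_mem_range_map_subtype (hψ : ∀ a, ψ (φ a) = seqIncl A a) (J : ClosedIdeal A) {b : B}
    (hb : b ∈ J.map φ) : ψ b ∈ NonUnitalStarAlgHom.range (SeqAlg.map J.subtype) := by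
  have hi : Function.Injective J.subtype := Subtype.val_injective
  refine apply_mem_of_mem_topologicalClosure_span ψ
    (isClosed_range_of_injective _ (SeqAlg.map_injective hi)) ?_ hb
  rintro _ ⟨b, j, hj, b', rfl⟩
  obtain ⟨a, ha⟩ := SeqAlg.mk_surjective A (ψ b)
  obtain ⟨a', ha'⟩ := SeqAlg.mk_surjective A (ψ b')
  rw [map_mul, map_mul, hψ, ← ha, ← ha']
  exact SeqAlg.mk_mem_range_map hi (b := a * constSeq j * a')
    fun n => ⟨⟨a n * j * a' n, J.mul_mem_right _ (J.mul_mem_left _ hj)⟩, rfl⟩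

theorem SeqSplit.idealRestrict (hφ : SeqSplit φ) (J : ClosedIdeal A) :
    SeqSplit (J.restrict φ) := by
  obtain ⟨ψ, hψ⟩ := seqSplit_iff.1 hφ
  exact SeqSplit.of_apply_mem_range hψ (i := J.subtype) Subtype.val_injective (J.map φ).subtype
    (fun _ => rfl) fun y => apply_mem_range_map_subtype hψ J y.2

theorem SeqAlg.map_quotientMk_map_subtype (J : ClosedIdeal A) (q : SeqAlg J) :
    SeqAlg.map (ClosedIdeal.Quotient.mk J) (SeqAlg.map J.subtype q) = 0 := by
  obtain ⟨j, rfl⟩ := SeqAlg.mk_surjective J q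
  have hj : boundedSeqMap (ClosedIdeal.Quotient.mk J) (boundedSeqMap J.subtype j) = 0 := by
    ext n
    exact (ClosedIdeal.Quotient.mk_eq_zero J).2 (j n).2
  rw [SeqAlg.map_mk, SeqAlg.map_mk, hj, map_zero]

theorem SeqSplit.quotientMap (hφ : SeqSplit φ) (J : ClosedIdeal A) :
    SeqSplit (J.quotientMap φ) := by
  obtain ⟨ψ, hψ⟩ := seqSplit_iff.1 hφ
  let π := ClosedIdeal.Quotient.mk J
  have hπψ : ∀ b ∈ J.map φ, (SeqAlg.map π).comp ψ b = 0 := fun b hb => by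
    obtain ⟨q, hq⟩ := apply_mem_range_map_subtype hψ J hb
    rw [NonUnitalStarAlgHom.comp_apply, ← hq]
    exact SeqAlg.map_quotientMk_map_subtype J q
  refine seqSplit_iff.2 ⟨ClosedIdeal.Quotient.lift (J.map φ) ((SeqAlg.map π).comp ψ) hπψ,
    (ClosedIdeal.Quotient.mk_surjective J).forall.2 fun a => ?_⟩
  rw [ClosedIdeal.quotientMap, ClosedIdeal.Quotient.map_mk, ClosedIdeal.Quotient.lift_mk,
    NonUnitalStarAlgHom.comp_apply, hψ, SeqAlg.map_seqIncl]

theorem SeqSplit.idealMap_injective (hφ : SeqSplit φ) : Function.Injective (ClosedIdeal.map φ) := by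
  obtain ⟨ψ, hψ⟩ := seqSplit_iff.1 hφ
  have mem_of_map_eq {J K : ClosedIdeal A} (h : J.map φ = K.map φ) {a : A} (ha : a ∈ J) :
      a ∈ K := by
    have hφa : φ a ∈ K.map φ := h ▸ J.apply_mem_map φ a ha
    obtain ⟨k, rfl⟩ := SeqAlg.mem_range_of_seqIncl_mem_range_map (i := K.subtype)
      Subtype.val_injective (hψ a ▸ apply_mem_range_map_subtype hψ K hφa)
    exact k.2
  exact fun J K h => SetLike.ext fun a => ⟨mem_of_map_eq h, mem_of_map_eq h.symm⟩

end Restrictions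

/-! ### Maximal tensor products and Cuntz comparison -/

namespace MaxTensor

section Universal

variable {A C E : Type*} [NonUnitalCStarAlgebra A] [NonUnitalCStarAlgebra C]
  [NonUnitalCStarAlgebra E]

variable (A C) in
/-- The canonical `*`-homomorphism from the algebraic to the maximal tensor product. -/
def ofHom : A ⊗[ℂ] C →⋆ₙₐ[ℂ] MaxTensor A C where
  toFun := of
  map_smul' c t := CStarSeminorm.Completion.of_smul _ c t
  map_zero' := CStarSeminorm.Completion.of_zero _
  map_add' s t := CStarSeminorm.Completion.of_add _ s t
  map_mul' s t := CStarSeminorm.Completion.of_mul _ s t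
  map_star' t := CStarSeminorm.Completion.of_star _ t

variable (A C) in
theorem denseRange_ofHom : DenseRange (ofHom A C) := CStarSeminorm.Completion.denseRange_of _

theorem norm_ofHom_tmul_le (a : A) (c : C) : ‖ofHom A C (a ⊗ₜ c)‖ ≤ ‖a‖ * ‖c‖ :=
  (CStarSeminorm.Completion.norm_of _ _).trans_le ((maxTensorNorm A C).tmul_le a c)

theorem map_ofHom_tmul {B D : Type*} [NonUnitalCStarAlgebra B] [NonUnitalCStarAlgebra D]
    (φ : A →⋆ₙₐ[ℂ] B) (ρ : C →⋆ₙₐ[ℂ] D) (a : A) (c : C) :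
    map φ ρ (ofHom A C (a ⊗ₜ c)) = ofHom B D (φ a ⊗ₜ ρ c) :=
  map_of_tmul φ ρ a c

theorem hom_ext {f g : MaxTensor A C →⋆ₙₐ[ℂ] E}
    (h : ∀ a c, f (ofHom A C (a ⊗ₜ c)) = g (ofHom A C (a ⊗ₜ c))) : f = g := by
  refine DFunLike.coe_injective
    ((denseRange_ofHom A C).equalizer (map_continuous f) (map_continuous g) (funext fun t => ?_))
  change f (ofHom A C t) = g (ofHom A C t)
  induction t with
  | zero => simp only [map_zero]
  | tmul a c => exact h a c
  | add s t hs ht => simp only [map_add, hs, ht]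

/-- The C⋆-seminorm `t ↦ ‖f t‖`. -/
def normSeminorm (f : A ⊗[ℂ] C →⋆ₙₐ[ℂ] E) : CStarSeminorm (A ⊗[ℂ] C) where
  toSeminorm := (_root_.normSeminorm ℂ E).comp (f : A ⊗[ℂ] C →ₗ[ℂ] E)
  mul_le' s t := by
    change ‖f (s * t)‖ ≤ ‖f s‖ * ‖f t‖
    rw [map_mul]
    exact norm_mul_le _ _
  star_mul_self' t := by
    change ‖f (star t * t)‖ = ‖f t‖ * ‖f t‖
    rw [map_mul, map_star, CStarRing.norm_star_mul_self]

theorem norm_apply_le_maxTensorNorm (f : A ⊗[ℂ] C →⋆ₙₐ[ℂ] E) (t : A ⊗[ℂ] C) :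
    ‖f t‖ ≤ maxTensorNorm A C t :=
  le_maxTensorNorm A C (normSeminorm f) t

/-- The function underlying `MaxTensor.lift`. -/
def liftFun (f : A ⊗[ℂ] C →⋆ₙₐ[ℂ] E) : MaxTensor A C → E :=
  UniformSpace.Completion.extension (α := (maxTensorNorm A C).Carrier) f

theorem continuous_liftFun (f : A ⊗[ℂ] C →⋆ₙₐ[ℂ] E) : Continuous (liftFun f) :=
  UniformSpace.Completion.continuous_extension

theorem liftFun_ofHom (f : A ⊗[ℂ] C →⋆ₙₐ[ℂ] E) (t : A ⊗[ℂ] C) :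
    liftFun f (ofHom A C t) = f t :=
  let F : (maxTensorNorm A C).Carrier →ₗ[ℂ] E :=
    { toFun := fun t => f t, map_add' := map_add f, map_smul' := map_smul f }
  UniformSpace.Completion.extension_coe (f := F) (F.mkContinuous 1 fun t => by
    rw [one_mul]; exact norm_apply_le_maxTensorNorm f t).uniformContinuous t

/-- The universal property of the maximal tensor product: a `*`-homomorphism on the algebraic
tensor product extends to `A ⊗_max C`. -/
def lift (f : A ⊗[ℂ] C →⋆ₙₐ[ℂ] E) : MaxTensor A C →⋆ₙₐ[ℂ] E :=
  have hf := continuous_liftFun f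
  have hd := denseRange_ofHom A C
  { toFun := liftFun f
    map_smul' := fun c a => hd.induction_on a
      (isClosed_eq (hf.comp (continuous_const_smul c)) (hf.const_smul c)) fun t => by
        simp only [← map_smul, liftFun_ofHom, MonoidHom.id_apply]
    map_zero' := by rw [← map_zero (ofHom A C), liftFun_ofHom, map_zero]
    map_add' := fun a b => hd.induction_on₂ (isClosed_eq (by fun_prop) (by fun_prop))
      (fun s t => by simp only [← map_add, liftFun_ofHom]) a b
    map_mul' := fun a b => hd.induction_on₂ (isClosed_eq (by fun_prop) (by fun_prop))
      (fun s t => by simp only [← map_mul, liftFun_ofHom]) a b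
    map_star' := fun a => hd.induction_on a (isClosed_eq (by fun_prop) (by fun_prop)) fun t => by
      simp only [← map_star, liftFun_ofHom] }

theorem lift_ofHom (f : A ⊗[ℂ] C →⋆ₙₐ[ℂ] E) (t : A ⊗[ℂ] C) : lift f (ofHom A C t) = f t :=
  liftFun_ofHom f t

/-- The `*`-homomorphism on the algebraic tensor product given by a multiplicative and
`*`-preserving bilinear map. -/
def algLift (β : A →ₗ[ℂ] C →ₗ[ℂ] E) (hmul : ∀ a a' c c', β (a * a') (c * c') = β a c * β a' c')
    (hstar : ∀ a c, β (star a) (star c) = star (β a c)) : A ⊗[ℂ] C →⋆ₙₐ[ℂ] E :=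
  { TensorProduct.lift β with
    map_zero' := map_zero _
    map_mul' := fun s t => by
      induction s with
      | zero => simp
      | add s s' hs hs' => simp_all [add_mul]
      | tmul a c =>
        induction t with
        | zero => simp
        | add t t' ht ht' => simp_all [mul_add]
        | tmul a' c' => simp [hmul]
    map_star' := fun t => by
      induction t with
      | zero => simp
      | add t t' ht ht' => simp_all
      | tmul a c => simp [hstar] }

theorem algLift_tmul (β : A →ₗ[ℂ] C →ₗ[ℂ] E)
    (hmul : ∀ a a' c c', β (a * a') (c * c') = β a c * β a' c')
    (hstar : ∀ a c, β (star a) (star c) = star (β a c)) (a : A) (c : C) :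
    algLift β hmul hstar (a ⊗ₜ c) = β a c :=
  TensorProduct.lift.tmul a c

end Universal

section SeqAlg

variable {A C : Type*} [NonUnitalCStarAlgebra A] [NonUnitalCStarAlgebra C]

theorem norm_ofHom_tmul_entry_le (a : ℓ^∞(ℕ, A)) (c : ℓ^∞(ℕ, C)) (n : ℕ) :
    ‖ofHom A C (a n ⊗ₜ c n)‖ ≤ ‖a‖ * ‖c‖ :=
  (norm_ofHom_tmul_le _ _).trans <|
    mul_le_mul (norm_entry_le a n) (norm_entry_le c n) (norm_nonneg _) (norm_nonneg _)

variable (A C) in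
/-- The bilinear map `((aₙ)ₙ, (cₙ)ₙ) ↦ (aₙ ⊗ cₙ)ₙ`. -/
def tensorSeq : ℓ^∞(ℕ, A) →ₗ[ℂ] ℓ^∞(ℕ, C) →ₗ[ℂ] ℓ^∞(ℕ, MaxTensor A C) :=
  LinearMap.mk₂ ℂ
    (fun a c => boundedSeq (fun n => ofHom A C (a n ⊗ₜ c n)) (‖a‖ * ‖c‖)
      (norm_ofHom_tmul_entry_le a c))
    (fun a a' c => by
      ext n
      exact (congrArg _ (TensorProduct.add_tmul (a n) (a' n) (c n))).trans
        (map_add (ofHom A C) _ _))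
    (fun z a c => by
      ext n
      exact (congrArg _ (TensorProduct.smul_tmul' z (a n) (c n)).symm).trans
        (map_smul (ofHom A C) z _))
    (fun a c c' => by
      ext n
      exact (congrArg _ (TensorProduct.tmul_add (a n) (c n) (c' n))).trans
        (map_add (ofHom A C) _ _))
    (fun z a c => by
      ext n
      exact (congrArg _ (TensorProduct.tmul_smul z (a n) (c n))).trans (map_smul (ofHom A C) z _))

theorem tensorSeq_mul_mul (a a' : ℓ^∞(ℕ, A)) (c c' : ℓ^∞(ℕ, C)) :
    tensorSeq A C (a * a') (c * c') = tensorSeq A C a c * tensorSeq A C a' c' := by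
  ext n
  exact (congrArg _ (Algebra.TensorProduct.tmul_mul_tmul _ _ _ _).symm).trans
    (map_mul (ofHom A C) (a n ⊗ₜ c n) (a' n ⊗ₜ c' n))

theorem tensorSeq_star_star (a : ℓ^∞(ℕ, A)) (c : ℓ^∞(ℕ, C)) :
    tensorSeq A C (star a) (star c) = star (tensorSeq A C a c) := by
  ext n
  exact map_star (ofHom A C) (a n ⊗ₜ c n)

variable (A C) in
/-- The bilinear map `A_∞ × C_∞ → (A ⊗_max C)_∞` induced by `tensorSeq`. -/
def tensorSeqAlg : SeqAlg A →ₗ[ℂ] SeqAlg C →ₗ[ℂ] SeqAlg (MaxTensor A C) :=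
  LinearMap.liftQ₂ (nullSequences A).toSubmodule (nullSequences C).toSubmodule
    ((tensorSeq A C).compr₂ (SeqAlg.mk (MaxTensor A C) : _ →ₗ[ℂ] SeqAlg (MaxTensor A C)))
    (fun a ha => LinearMap.ext fun c => SeqAlg.mk_eq_zero.2 <|
      squeeze_zero (fun _ => norm_nonneg _) (fun n => (norm_ofHom_tmul_le _ _).trans <|
        mul_le_mul_of_nonneg_left (norm_entry_le c n) (norm_nonneg _)) <| by
          simpa using Tendsto.mul_const ‖c‖ ha)
    (fun c hc => LinearMap.ext fun a => SeqAlg.mk_eq_zero.2 <|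
      squeeze_zero (fun _ => norm_nonneg _) (fun n => (norm_ofHom_tmul_le _ _).trans <|
        mul_le_mul_of_nonneg_right (norm_entry_le a n) (norm_nonneg _)) <| by
          simpa using Tendsto.const_mul ‖a‖ hc)

theorem tensorSeqAlg_mk_mk (a : ℓ^∞(ℕ, A)) (c : ℓ^∞(ℕ, C)) :
    tensorSeqAlg A C (SeqAlg.mk A a) (SeqAlg.mk C c) = SeqAlg.mk _ (tensorSeq A C a c) := rfl

variable (A C) in
/-- The canonical `*`-homomorphism `A_∞ ⊗_max C_∞ → (A ⊗_max C)_∞`. -/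
def seqAlgHom : MaxTensor (SeqAlg A) (SeqAlg C) →⋆ₙₐ[ℂ] SeqAlg (MaxTensor A C) :=
  lift <| algLift (tensorSeqAlg A C)
    ((SeqAlg.mk_surjective A).forall₂.2 fun a a' => (SeqAlg.mk_surjective C).forall₂.2
      fun c c' => by simp only [← map_mul, tensorSeqAlg_mk_mk, tensorSeq_mul_mul])
    ((SeqAlg.mk_surjective A).forall.2 fun a => (SeqAlg.mk_surjective C).forall.2
      fun c => by simp only [← map_star, tensorSeqAlg_mk_mk, tensorSeq_star_star])

theorem seqAlgHom_seqIncl_tmul_seqIncl (a : A) (c : C) :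
    seqAlgHom A C (ofHom _ _ (seqIncl A a ⊗ₜ seqIncl C c)) = seqIncl _ (ofHom A C (a ⊗ₜ c)) :=
  (lift_ofHom _ _).trans (algLift_tmul _ _ _ _ _)

end SeqAlg

end MaxTensor

theorem SeqSplit.maxTensorMap {A B C D : Type*} [NonUnitalCStarAlgebra A]
    [NonUnitalCStarAlgebra B] [NonUnitalCStarAlgebra C] [NonUnitalCStarAlgebra D]
    {φ : A →⋆ₙₐ[ℂ] B} (hφ : SeqSplit φ) {ρ : C →⋆ₙₐ[ℂ] D} (hρ : SeqSplit ρ) :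
    SeqSplit (MaxTensor.map φ ρ) := by
  obtain ⟨ψ, hψ⟩ := seqSplit_iff.1 hφ
  obtain ⟨σ, hσ⟩ := seqSplit_iff.1 hρ
  refine ⟨(MaxTensor.seqAlgHom A C).comp (MaxTensor.map ψ σ), MaxTensor.hom_ext fun a c => ?_⟩
  rw [NonUnitalStarAlgHom.comp_apply, NonUnitalStarAlgHom.comp_apply, MaxTensor.map_ofHom_tmul,
    MaxTensor.map_ofHom_tmul, hψ, hσ, MaxTensor.seqAlgHom_seqIncl_tmul_seqIncl]

theorem SeqSplit.id (A : Type*) [NonUnitalCStarAlgebra A] :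
    SeqSplit (NonUnitalStarAlgHom.id ℂ A) := ⟨seqIncl A, rfl⟩

section Cuntz

variable {A B : Type*} [NonUnitalCStarAlgebra A] [NonUnitalCStarAlgebra B] {φ : A →⋆ₙₐ[ℂ] B}

theorem SeqSplit.cuntzLE (hφ : SeqSplit φ) {a b : A} (h : CuntzLE (φ a) (φ b)) : CuntzLE a b := by
  obtain ⟨ψ, hψ⟩ := seqSplit_iff.1 hφ
  intro ε hε
  obtain ⟨y, hy⟩ := h ε hε
  obtain ⟨z, hz⟩ := SeqAlg.mk_surjective A (ψ y)
  have hψy : ψ (y * φ b * star y - φ a) = SeqAlg.mk A (z * constSeq b * star z - constSeq a) := by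
    rw [map_sub, map_mul, map_mul, map_star, hψ, hψ, ← hz]
    rfl
  obtain ⟨n, hn⟩ := (SeqAlg.eventually_norm_lt
    ((hψy ▸ NonUnitalStarAlgHom.norm_apply_le ψ _).trans_lt hy)).exists
  exact ⟨z n, hn⟩

theorem SeqSplit.cuMap_le_iff (hφ : SeqSplit φ) (a b : Cu A) :
    Cu.map φ a ≤ Cu.map φ b ↔ a ≤ b := by
  refine ⟨?_, fun h => (Cu.map φ).monotone h⟩
  induction a using Quotient.inductionOn with | _ a
  induction b using Quotient.inductionOn with | _ b
  exact (hφ.maxTensorMap (SeqSplit.id CompactOp)).cuntzLE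

end Cuntz

/-! ### Limit traces -/

section Traces

variable {A : Type*} [NonUnitalCStarAlgebra A]

theorem tendsto_hyperfilter_limUnder (τ : A →L[ℂ] ℂ) (a : ℓ^∞(ℕ, A)) :
    Tendsto (fun n => τ (a n)) (hyperfilter ℕ)
      (𝓝 (limUnder (hyperfilter ℕ : Filter ℕ) fun n => τ (a n))) := by
  have hmem (n : ℕ) : τ (a n) ∈ Metric.closedBall (0 : ℂ) (‖τ‖ * ‖a‖) :=
    mem_closedBall_zero_iff.2 (τ.le_opNorm_of_le (norm_entry_le a n))
  obtain ⟨z, -, hz⟩ := (isCompact_closedBall (0 : ℂ) (‖τ‖ * ‖a‖)).ultrafilter_le_nhds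
    ((hyperfilter ℕ).map fun n => τ (a n)) (tendsto_principal.2 (Eventually.of_forall hmem))
  exact tendsto_nhds_limUnder ⟨z, hz⟩

/-- The functional on `ℓ^∞(ℕ, A)` given by the limit of `τ (a n)` along a free ultrafilter. -/
def ultralimit (τ : A →L[ℂ] ℂ) : ℓ^∞(ℕ, A) →ₗ[ℂ] ℂ where
  toFun a := limUnder (hyperfilter ℕ : Filter ℕ) fun n => τ (a n)
  map_add' a b := tendsto_nhds_unique (tendsto_hyperfilter_limUnder τ (a + b)) <|
    ((tendsto_hyperfilter_limUnder τ a).add (tendsto_hyperfilter_limUnder τ b)).congr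
      fun n => (map_add τ (a n) (b n)).symm
  map_smul' c a := tendsto_nhds_unique (tendsto_hyperfilter_limUnder τ (c • a)) <|
    ((tendsto_hyperfilter_limUnder τ a).const_smul c).congr fun n => (map_smul τ c (a n)).symm

theorem norm_ultralimit_le (τ : A →L[ℂ] ℂ) (a : ℓ^∞(ℕ, A)) :
    ‖ultralimit τ a‖ ≤ ‖τ‖ * ‖SeqAlg.mk A a‖ := by
  refine le_mul_of_forall_lt₀ fun M hM r hr => ?_
  refine le_of_tendsto (tendsto_hyperfilter_limUnder τ a).norm ?_
  filter_upwards [Nat.hyperfilter_le_atTop (SeqAlg.eventually_norm_lt hr)] with n hn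
  exact (τ.le_opNorm _).trans (mul_le_mul hM.le hn.le (norm_nonneg _) ((norm_nonneg _).trans hM.le))

/-- The functional on `A_∞` given by the limit of `τ (a n)` along a free ultrafilter. -/
def limitFunctional (τ : A →L[ℂ] ℂ) : SeqAlg A →L[ℂ] ℂ :=
  LinearMap.mkContinuous
    ((nullSequences A).toSubmodule.liftQ (ultralimit τ) fun a ha => by
      have h := norm_ultralimit_le τ a
      rwa [(ClosedIdeal.Quotient.mk_eq_zero _).2 ha, norm_zero, mul_zero, norm_le_zero_iff] at h)
    ‖τ‖ ((SeqAlg.mk_surjective A).forall.2 (norm_ultralimit_le τ))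

theorem norm_limitFunctional_le (τ : A →L[ℂ] ℂ) : ‖limitFunctional τ‖ ≤ ‖τ‖ :=
  LinearMap.mkContinuous_norm_le _ (norm_nonneg _) _

theorem tendsto_limitFunctional (τ : A →L[ℂ] ℂ) (a : ℓ^∞(ℕ, A)) :
    Tendsto (fun n => τ (a n)) (hyperfilter ℕ) (𝓝 (limitFunctional τ (SeqAlg.mk A a))) :=
  tendsto_hyperfilter_limUnder τ a

theorem limitFunctional_seqIncl (τ : A →L[ℂ] ℂ) (a : A) :
    limitFunctional τ (seqIncl A a) = τ a :=
  tendsto_nhds_unique (tendsto_limitFunctional τ (constSeq a)) tendsto_const_nhds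

theorem limitFunctional_star_mul_self {τ : A →L[ℂ] ℂ}
    (hτ : ∀ a : A, 0 ≤ (τ (star a * a)).re ∧ (τ (star a * a)).im = 0) (q : SeqAlg A) :
    0 ≤ (limitFunctional τ (star q * q)).re ∧ (limitFunctional τ (star q * q)).im = 0 := by
  obtain ⟨a, rfl⟩ := SeqAlg.mk_surjective A q
  have h : Tendsto (fun n => τ (star (a n) * a n)) (hyperfilter ℕ)
      (𝓝 (limitFunctional τ (star (SeqAlg.mk A a) * SeqAlg.mk A a))) :=
    tendsto_limitFunctional τ (star a * a)
  exact ⟨ge_of_tendsto' ((Complex.continuous_re.tendsto _).comp h) fun n => (hτ (a n)).1,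
    tendsto_nhds_unique ((Complex.continuous_im.tendsto _).comp h)
      (tendsto_const_nhds.congr fun n => (hτ (a n)).2.symm)⟩

theorem limitFunctional_mul_comm {τ : A →L[ℂ] ℂ} (hτ : ∀ a b : A, τ (a * b) = τ (b * a))
    (q r : SeqAlg A) : limitFunctional τ (q * r) = limitFunctional τ (r * q) := by
  obtain ⟨a, rfl⟩ := SeqAlg.mk_surjective A q
  obtain ⟨b, rfl⟩ := SeqAlg.mk_surjective A r
  exact tendsto_nhds_unique (tendsto_limitFunctional τ (a * b))
    ((tendsto_limitFunctional τ (b * a)).congr fun n => hτ (b n) (a n))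

theorem SeqSplit.exists_tracialState {B : Type*} [NonUnitalCStarAlgebra B] {φ : A →⋆ₙₐ[ℂ] B}
    (hφ : SeqSplit φ) (τ : TracialState A) : ∃ σ : TracialState B, ∀ a : A, σ (φ a) = τ a := by
  obtain ⟨ψ, hψ⟩ := seqSplit_iff.1 hφ
  let σ : B →L[ℂ] ℂ :=
    (limitFunctional τ.toFun).comp { (ψ : B →ₗ[ℂ] SeqAlg A) with cont := map_continuous ψ }
  have hσφ (a : A) : σ (φ a) = τ a :=
    (congrArg (limitFunctional τ.toFun) (hψ a)).trans (limitFunctional_seqIncl τ.toFun a)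
  have hσ_le : ‖σ‖ ≤ ‖τ.toFun‖ := σ.opNorm_le_bound (norm_nonneg _) fun b =>
    ((limitFunctional τ.toFun).le_opNorm (ψ b)).trans <| mul_le_mul (norm_limitFunctional_le _)
      (NonUnitalStarAlgHom.norm_apply_le ψ b) (norm_nonneg _) (norm_nonneg _)
  have hσ_ge : ‖τ.toFun‖ ≤ ‖σ‖ := τ.toFun.opNorm_le_bound (norm_nonneg _) fun a => by
    rw [← hσφ]
    exact σ.le_opNorm_of_le (NonUnitalStarAlgHom.norm_apply_le φ a)
  refine ⟨⟨σ, fun b => ?_, (hσ_le.antisymm hσ_ge).trans τ.norm_eq_one', fun b c => ?_⟩, hσφ⟩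
  · change 0 ≤ (limitFunctional τ.toFun (ψ (star b * b))).re ∧
      (limitFunctional τ.toFun (ψ (star b * b))).im = 0
    rw [map_mul, map_star]
    exact limitFunctional_star_mul_self τ.nonneg' (ψ b)
  · change limitFunctional τ.toFun (ψ (b * c)) = limitFunctional τ.toFun (ψ (c * b))
    rw [map_mul ψ, map_mul ψ]
    exact limitFunctional_mul_comm τ.trace' (ψ b) (ψ c)

end Traces

/-! ### Murray–von Neumann equivalence and K-theory -/

section Stability

open Matrix

theorem spectrum_pos_of_norm_one_sub_lt {M : Type*} [CStarAlgebra M] {a : M} (ha : ‖1 - a‖ < 1)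
    {t : ℝ} (ht : t ∈ spectrum ℝ a) : 0 < t := by
  rcases subsingleton_or_nontrivial M with _ | _
  · simp [spectrum.of_subsingleton] at ht
  have hmem : 1 - t ∈ spectrum ℝ (1 - a) := by
    rw [← map_one (algebraMap ℝ M), ← spectrum.singleton_sub_eq]
    exact Set.sub_mem_sub rfl ht
  have hlt : 1 - t < 1 :=
    (le_abs_self (1 - t)).trans_lt ((spectrum.norm_le_norm_of_mem hmem).trans_lt ha)
  linarith

theorem exists_inv_sqrt {M : Type*} [CStarAlgebra M] {a : M} (ha : ‖1 - a‖ < 1)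
    (hsa : IsSelfAdjoint a) :
    ∃ h : M, IsSelfAdjoint h ∧ h * h * a = 1 ∧ ∀ b, Commute a b → Commute h b := by
  have hpos (t : ℝ) (ht : t ∈ spectrum ℝ a) : 0 < √t :=
    Real.sqrt_pos.2 (spectrum_pos_of_norm_one_sub_lt ha ht)
  have hcont : ContinuousOn (fun t : ℝ => (√t)⁻¹) (spectrum ℝ a) :=
    Real.continuous_sqrt.continuousOn.inv₀ fun t ht => (hpos t ht).ne'
  refine ⟨cfc (fun t : ℝ => (√t)⁻¹) a, cfc_predicate _ _, ?_, fun b hb => hb.cfc_real _⟩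
  calc cfc (fun t : ℝ => (√t)⁻¹) a * cfc (fun t : ℝ => (√t)⁻¹) a * a
      = cfc (fun t : ℝ => (√t)⁻¹ * (√t)⁻¹ * t) a := by
        rw [cfc_mul (fun t : ℝ => (√t)⁻¹ * (√t)⁻¹) (fun t => t) a (hcont.mul hcont)
          continuousOn_id, cfc_mul _ _ a hcont hcont, cfc_id' ℝ a]
    _ = cfc (fun _ : ℝ => (1 : ℝ)) a := cfc_congr fun t ht => by
        have ht' : √t * √t = t := Real.mul_self_sqrt (Real.sqrt_pos.1 (hpos t ht)).le
        have := (hpos t ht).ne'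
        field_simp
        rw [sq, ht']
    _ = 1 := cfc_const_one ℝ a

theorem exists_inv_sqrt_in_corner {M : Type*} [CStarAlgebra M] {b q : M} (hq : IsStarProjection q)
    (hb : IsSelfAdjoint b) (hbq : b * q = b) (hlt : ‖b - q‖ < 1) :
    ∃ h : M, IsSelfAdjoint h ∧ Commute h b ∧ h * h * b = q := by
  have hqq : q * q = q := hq.isIdempotentElem
  have hqb : q * b = b := by
    simpa only [star_mul, hb.star_eq, hq.isSelfAdjoint.star_eq] using congrArg star hbq
  obtain ⟨h, hsa, hmul, hcomm⟩ := exists_inv_sqrt (a := b + (1 - q))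
    (by rwa [show (1 : M) - (b + (1 - q)) = -(b - q) by abel, norm_neg])
    (hb.add ((IsSelfAdjoint.one M).sub hq.isSelfAdjoint))
  have hcorner : (b + (1 - q)) * q = b := by
    rw [add_mul, sub_mul, one_mul, hqq, sub_self, add_zero, hbq]
  refine ⟨h, hsa, hcomm b ?_, ?_⟩
  · simp only [Commute, SemiconjBy, add_mul, mul_add, sub_mul, mul_sub, one_mul, mul_one, hqb, hbq]
  · calc h * h * b = h * h * (b + (1 - q)) * q := by rw [mul_assoc _ _ q, hcorner]
      _ = q := by rw [hmul, one_mul]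

/-- `b` is invertible in the corner with unit `p`, so `w * b = p * b` can be cancelled. -/
theorem eq_of_mul_eq_of_norm_sub_lt {M : Type*} [NonUnitalNormedRing M] {p b w : M}
    (hp : p * p = p) (hwp : w * p = w) (hpb : p * b = b) (hwb : w * b = b) (hlt : ‖b - p‖ < 1) :
    w = p := by
  have hfix : w - p = (w - p) * (p - b) := by
    rw [mul_sub, sub_mul, sub_mul, hwp, hp, hwb, hpb, sub_self, sub_zero]
  have hle : ‖w - p‖ ≤ ‖w - p‖ * ‖b - p‖ := by
    rw [norm_sub_rev b p]
    exact (congrArg norm hfix).le.trans (norm_mul_le _ _)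
  rw [← sub_eq_zero, ← norm_le_zero_iff]
  by_contra! hpos
  exact (mul_lt_of_lt_one_right hpos hlt).not_ge hle

variable {R : Type*} [CStarAlgebra R] [PartialOrder R] [StarOrderedRing R] {ι κ : Type}
  [Fintype ι] [Fintype κ]

/-- The partial isometry is the polar part `y (yᴴ y)^(-1/2)`. -/
theorem MvN.of_norm_lt {p : Matrix ι ι R} {q : Matrix κ κ R} (hp : IsStarProjection p)
    (hq : IsStarProjection q) {y : Matrix ι κ R} (hpy : p * y = y) (hyq : y * q = y)
    (hyy : ‖CStarMatrix.ofMatrix (y * yᴴ - p)‖ < 1)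
    (hyy' : ‖CStarMatrix.ofMatrix (yᴴ * y - q)‖ < 1) : MvN p q := by
  classical
  obtain ⟨h, hsa, hcomm, hsq⟩ : ∃ h : Matrix κ κ R,
      hᴴ = h ∧ h * (yᴴ * y) = yᴴ * y * h ∧ h * h * (yᴴ * y) = q :=
    exists_inv_sqrt_in_corner (M := CStarMatrix κ κ R) (b := yᴴ * y) (q := q)
      ⟨hq.isIdempotentElem, hq.isSelfAdjoint⟩ (isHermitian_conjTranspose_mul_self y)
      ((Matrix.mul_assoc _ _ _).trans (congrArg (yᴴ * ·) hyq)) hyy'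
  refine ⟨y * h, ?_, ?_⟩
  · have hyp : yᴴ * p = yᴴ := by
      simpa only [conjTranspose_mul, hp.isSelfAdjoint.isHermitian.eq] using
        congrArg conjTranspose hpy
    have hwb : y * h * (y * h)ᴴ * (y * yᴴ) = y * yᴴ := by
      calc y * h * (y * h)ᴴ * (y * yᴴ) = y * (h * h * (yᴴ * y)) * yᴴ := by
            simp only [conjTranspose_mul, hsa, Matrix.mul_assoc]
        _ = y * yᴴ := by rw [hsq, hyq]
    refine eq_of_mul_eq_of_norm_sub_lt (M := CStarMatrix ι ι R) hp.isIdempotentElem ?_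
      ((Matrix.mul_assoc _ _ _).symm.trans (congrArg (· * yᴴ) hpy)) hwb hyy
    change y * h * (y * h)ᴴ * p = y * h * (y * h)ᴴ
    rw [conjTranspose_mul, Matrix.mul_assoc, Matrix.mul_assoc hᴴ, hyp]
  · calc (y * h)ᴴ * (y * h) = h * (yᴴ * y * h) := by
          simp only [conjTranspose_mul, hsa, Matrix.mul_assoc]
      _ = q := by rw [← hcomm, ← Matrix.mul_assoc, hsq]

end Stability

section Lifting

open Matrix

section

variable (A : Type*) [NonUnitalCStarAlgebra A]

/-- The inclusion of `A` into `ℓ^∞(ℕ, A)` as constant sequences. -/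
def constSeqHom : A →⋆ₙₐ[ℂ] ℓ^∞(ℕ, A) where
  toFun := constSeq
  map_smul' _ _ := rfl
  map_zero' := rfl
  map_add' _ _ := rfl
  map_mul' _ _ := rfl
  map_star' _ := rfl

/-- Evaluation of bounded sequences at `n`. -/
def evalSeqHom (n : ℕ) : ℓ^∞(ℕ, A) →⋆ₙₐ[ℂ] A where
  toFun a := a n
  map_smul' _ _ := rfl
  map_zero' := rfl
  map_add' _ _ := rfl
  map_mul' _ _ := rfl
  map_star' _ := rfl

end

theorem MvN.exists_mul_eq {R : Type*} [Ring R] [StarRing R] {ι κ : Type} [Fintype ι] [Fintype κ]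
    {p : Matrix ι ι R} {q : Matrix κ κ R} (hp : IsStarProjection p) (hq : IsStarProjection q)
    (h : MvN p q) :
    ∃ v : Matrix ι κ R, v * vᴴ = p ∧ vᴴ * v = q ∧ p * v = v ∧ v * q = v := by
  obtain ⟨v, hvp, hvq⟩ := h
  have hpp : p * p = p := hp.isIdempotentElem
  have hqq : q * q = q := hq.isIdempotentElem
  have hadj : (p * v * q)ᴴ = q * vᴴ * p := by
    rw [conjTranspose_mul, conjTranspose_mul, hp.isSelfAdjoint.isHermitian.eq,
      hq.isSelfAdjoint.isHermitian.eq, Matrix.mul_assoc]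
  refine ⟨p * v * q, ?_, ?_, ?_, ?_⟩
  · calc p * v * q * (p * v * q)ᴴ = p * (v * (q * q) * vᴴ) * p := by
          rw [hadj]; simp only [Matrix.mul_assoc]
      _ = p * (v * vᴴ * (v * vᴴ)) * p := by
          rw [hqq, ← hvq]; simp only [Matrix.mul_assoc]
      _ = p := by simp only [hvp, hpp]
  · calc (p * v * q)ᴴ * (p * v * q) = q * (vᴴ * (p * p) * v) * q := by
          rw [hadj]; simp only [Matrix.mul_assoc]
      _ = q * (vᴴ * v * (vᴴ * v)) * q := by
          rw [hpp, ← hvp]; simp only [Matrix.mul_assoc]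
      _ = q := by simp only [hvq, hqq]
  · rw [← Matrix.mul_assoc, ← Matrix.mul_assoc, hpp]
  · rw [Matrix.mul_assoc, hqq]

variable {R S : Type*} [CStarAlgebra R] [CStarAlgebra S] {ι κ : Type} [Fintype ι] [Fintype κ]

theorem tendsto_norm_map_evalSeqHom_sub [PartialOrder R] [StarOrderedRing R]
    {a : Matrix ι κ ℓ^∞(ℕ, R)} {m : Matrix ι κ R}
    (h : a.map (SeqAlg.mk R) = m.map (seqIncl R)) :
    Tendsto (fun n => ‖CStarMatrix.ofMatrix (a.map (evalSeqHom R n) - m)‖) atTop (𝓝 0) := by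
  have hentry : Tendsto (fun n => a.map (evalSeqHom R n) - m) atTop (𝓝 0) :=
    tendsto_pi_nhds.2 fun i => tendsto_pi_nhds.2 fun j => tendsto_sub_nhds_zero_iff.2 <|
      SeqAlg.mk_eq_seqIncl.1 (congrFun (congrFun h i) j)
  have hcont := (CStarMatrix.ofMatrixL (m := ι) (n := κ) (A := R)).continuous.tendsto 0
  rw [map_zero] at hcont
  exact tendsto_zero_iff_norm_tendsto_zero.1 (hcont.comp hentry)

theorem isStarProjection_map (f : R →⋆ₐ[ℂ] S) {p : Matrix ι ι R} (hp : IsStarProjection p) :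
    IsStarProjection (p.map f) where
  isIdempotentElem := by rw [IsIdempotentElem, ← Matrix.map_mul, hp.isIdempotentElem.eq]
  isSelfAdjoint := by
    rw [IsSelfAdjoint, star_eq_conjTranspose, ← conjTranspose_map _ (map_star f),
      hp.isSelfAdjoint.isHermitian.eq]

theorem MvN.of_map (f : R →⋆ₐ[ℂ] S) (g : S →⋆ₙₐ[ℂ] SeqAlg R) (hg : ∀ r, g (f r) = seqIncl R r)
    {p : Matrix ι ι R} {q : Matrix κ κ R} (hp : IsStarProjection p) (hq : IsStarProjection q)
    (h : MvN (p.map f) (q.map f)) : MvN p q := by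
  let _ : PartialOrder R := CStarAlgebra.spectralOrder R
  have : StarOrderedRing R := CStarAlgebra.spectralOrderedRing R
  obtain ⟨v, hvp, hvq, hpv, hqv⟩ := h.exists_mul_eq (isStarProjection_map f hp)
    (isStarProjection_map f hq)
  choose s hs using SeqAlg.mk_surjective R
  let z : Matrix ι κ ℓ^∞(ℕ, R) :=
    p.map (constSeqHom R) * (v.map fun b => s (g b)) * q.map (constSeqHom R)
  have hgf {μ : Type} (m : Matrix μ μ R) : (m.map f).map g = m.map (seqIncl R) :=
    Matrix.ext fun _ _ => hg _
  have hconst {μ : Type} (m : Matrix μ μ R) :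
      (m.map (constSeqHom R)).map (SeqAlg.mk R) = (m.map f).map g := (hgf m).symm
  have hz : z.map (SeqAlg.mk R) = v.map g := by
    have hv : (v.map fun b => s (g b)).map (SeqAlg.mk R) = v.map g := Matrix.ext fun _ _ => hs _
    rw [Matrix.map_mul, Matrix.map_mul, hconst, hconst, hv, ← Matrix.map_mul, ← Matrix.map_mul,
      hpv, hqv]
  have hzz : (z * zᴴ).map (SeqAlg.mk R) = p.map (seqIncl R) := by
    rw [Matrix.map_mul, conjTranspose_map _ (map_star _), hz, ← conjTranspose_map _ (map_star g),
      ← Matrix.map_mul, hvp, hgf]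
  have hzz' : (zᴴ * z).map (SeqAlg.mk R) = q.map (seqIncl R) := by
    rw [Matrix.map_mul, conjTranspose_map _ (map_star _), hz, ← conjTranspose_map _ (map_star g),
      ← Matrix.map_mul, hvq, hgf]
  obtain ⟨n, hn, hn'⟩ :=
    (((tendsto_norm_map_evalSeqHom_sub hzz).eventually_lt_const zero_lt_one).and
      ((tendsto_norm_map_evalSeqHom_sub hzz').eventually_lt_const zero_lt_one)).exists
  rw [Matrix.map_mul, conjTranspose_map _ (map_star _)] at hn hn'
  have hzn : z.map (evalSeqHom R n) = p * (v.map fun b => s (g b)).map (evalSeqHom R n) * q := by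
    rw [Matrix.map_mul, Matrix.map_mul]
    rfl
  refine MvN.of_norm_lt hp hq (y := z.map (evalSeqHom R n)) ?_ ?_ hn hn'
  · rw [hzn, ← Matrix.mul_assoc, ← Matrix.mul_assoc, hp.isIdempotentElem.eq]
  · rw [hzn, Matrix.mul_assoc, hq.isIdempotentElem.eq]

end Lifting

section GrothendieckGroup

open Algebra (GrothendieckAddGroup)

variable {M N : Type*} [AddCommMonoid M] [AddCommMonoid N]

theorem grothendieckAddGroup_of_eq_of {a b : M} :
    GrothendieckAddGroup.of a = GrothendieckAddGroup.of b ↔ ∃ c, c + a = c + b :=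
  (AddLocalization.addMonoidOf (⊤ : AddSubmonoid M)).eq_iff_exists.trans
    ⟨fun ⟨c, hc⟩ => ⟨c, hc⟩, fun ⟨c, hc⟩ => ⟨⟨c, trivial⟩, hc⟩⟩

/-- The element of `N` that witnesses an equality in its Grothendieck group is absorbed into the
range of `f`. -/
theorem grothendieckAddGroup_lift_injective {f : M →+ N} (hf : Function.Injective f)
    (hcofinal : ∀ c, ∃ d m, c + d = f m) :
    Function.Injective (GrothendieckAddGroup.lift (GrothendieckAddGroup.of.comp f)) := by
  rw [injective_iff_map_eq_zero]
  intro z hz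
  obtain ⟨⟨a, b, _⟩, hab⟩ := (AddLocalization.addMonoidOf (⊤ : AddSubmonoid M)).surj z
  replace hab : z + GrothendieckAddGroup.of b = GrothendieckAddGroup.of a := hab
  have hlift (m : M) : GrothendieckAddGroup.lift (GrothendieckAddGroup.of.comp f)
      (GrothendieckAddGroup.of m) = GrothendieckAddGroup.of (f m) :=
    DFunLike.congr_fun (GrothendieckAddGroup.lift.symm_apply_apply _) m
  have himage : GrothendieckAddGroup.of (f b) = GrothendieckAddGroup.of (f a) := by
    rw [← hlift, ← hlift, ← hab, map_add, hz, zero_add]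
  obtain ⟨c, hc⟩ := grothendieckAddGroup_of_eq_of.1 himage
  obtain ⟨d, m, hd⟩ := hcofinal c
  have hm : m + b = m + a := hf <| by
    rw [map_add, map_add, ← hd, add_comm c d, add_assoc, hc, add_assoc]
  rw [← grothendieckAddGroup_of_eq_of.2 ⟨m, hm⟩] at hab
  exact add_eq_right.1 hab

end GrothendieckGroup

section Injectivity

open Matrix

/-- The class of the unit of the `k × k` matrices. -/
def MvNSemigroup.unitClass (R : Type*) [Ring R] [StarRing R] (k : ℕ) : MvNSemigroup R :=
  Quotient.mk _ ⟨k, 1, .one _⟩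

theorem MvNSemigroup.exists_add_eq_unitClass {R : Type*} [Ring R] [StarRing R]
    (c : MvNSemigroup R) : ∃ d k, c + d = unitClass R k := by
  induction c using Quotient.inductionOn with | _ r
  have hmul : r.mat * r.mat = r.mat := r.isProj.isIdempotentElem
  have hstar : r.matᴴ = r.mat := r.isProj.isSelfAdjoint
  let r' : ProjMat R := ⟨r.size, 1 - r.mat, r.isProj.one_sub⟩
  have h : MvN (1 : Matrix (Fin r.size) (Fin r.size) R)
      (Matrix.fromBlocks r.mat 0 0 (1 - r.mat)) := by
    refine ⟨Matrix.fromCols r.mat (1 - r.mat), ?_, ?_⟩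
    · rw [conjTranspose_fromCols_eq_fromRows_conjTranspose, fromCols_mul_fromRows]
      simp [hstar, hmul, mul_sub, sub_mul]
    · rw [conjTranspose_fromCols_eq_fromRows_conjTranspose, fromRows_mul_fromCols]
      simp [hstar, hmul, mul_sub, sub_mul]
  exact ⟨Quotient.mk _ r', r.size,
    Quotient.sound (h.trans (.one _) (r.add r').isProj (r.mvN_add r')).symm⟩

variable {R S : Type*} [CStarAlgebra R] [CStarAlgebra S]

theorem MvNSemigroup.map_unitClass (f : R →⋆ₐ[ℂ] S) (k : ℕ) :
    map f (unitClass R k) = unitClass S k := by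
  refine Quotient.sound ?_
  change MvN ((1 : Matrix (Fin k) (Fin k) R).map f) (1 : Matrix (Fin k) (Fin k) S)
  rw [Matrix.map_one f (map_zero f) (map_one f)]
  exact MvN.refl (.one _)

theorem MvNSemigroup.map_injective (f : R →⋆ₐ[ℂ] S) (g : S →⋆ₙₐ[ℂ] SeqAlg R)
    (hg : ∀ r, g (f r) = seqIncl R r) : Function.Injective (map f) := by
  intro a b hab
  induction a using Quotient.inductionOn with | _ p
  induction b using Quotient.inductionOn with | _ q
  exact Quotient.sound (MvN.of_map f g hg p.isProj q.isProj (Quotient.exact hab))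

theorem UnitalK0.map_injective {f : R →⋆ₐ[ℂ] S} (hf : Function.Injective (MvNSemigroup.map f)) :
    Function.Injective (UnitalK0.map f) :=
  grothendieckAddGroup_lift_injective hf fun c => by
    obtain ⟨d, k, hd⟩ := c.exists_add_eq_unitClass
    exact ⟨d, .unitClass R k, hd.trans (MvNSemigroup.map_unitClass f k).symm⟩

theorem seqIncl_one_mul (x : SeqAlg R) : seqIncl R 1 * x = x := by
  obtain ⟨a, rfl⟩ := SeqAlg.mk_surjective R x
  rw [← SeqAlg.mk_constSeq, ← map_mul]
  exact congrArg _ (lp.ext (funext fun n => one_mul (a n)))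

theorem mul_seqIncl_one (x : SeqAlg R) : x * seqIncl R 1 = x := by
  obtain ⟨a, rfl⟩ := SeqAlg.mk_surjective R x
  rw [← SeqAlg.mk_constSeq, ← map_mul]
  exact congrArg _ (lp.ext (funext fun n => mul_one (a n)))

variable {A B : Type*} [NonUnitalCStarAlgebra A] [NonUnitalCStarAlgebra B]

/-- The extension of a `*`-homomorphism `B → A_∞` to the unitization, with values in `(A~)_∞`. -/
def unitizationSeqHom (ψ : B →⋆ₙₐ[ℂ] SeqAlg A) :
    Unitization ℂ B →⋆ₙₐ[ℂ] SeqAlg (Unitization ℂ A) where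
  toFun b := b.fst • seqIncl (Unitization ℂ A) 1 +
    SeqAlg.map (Unitization.inrNonUnitalStarAlgHom ℂ A) (ψ b.snd)
  map_smul' c b := by simp [smul_smul]
  map_zero' := by simp
  map_add' b c := by
    simp only [Unitization.fst_add, Unitization.snd_add, add_smul, map_add]
    abel
  map_mul' b c := by
    simp only [Unitization.fst_mul, Unitization.snd_mul, map_add, map_mul ψ, map_mul (SeqAlg.map _),
      map_smul, add_mul, mul_add, smul_add, smul_mul_assoc, mul_smul_comm, seqIncl_one_mul,
      mul_seqIncl_one, smul_smul, mul_comm c.fst b.fst]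
    abel
  map_star' b := by
    simp [map_star, ← map_star (seqIncl (Unitization ℂ A))]

theorem unitizationSeqHom_starMap {φ : A →⋆ₙₐ[ℂ] B} {ψ : B →⋆ₙₐ[ℂ] SeqAlg A}
    (h : ∀ a, ψ (φ a) = seqIncl A a) (r : Unitization ℂ A) :
    unitizationSeqHom ψ (Unitization.starMap φ r) = seqIncl (Unitization ℂ A) r := by
  calc unitizationSeqHom ψ (Unitization.starMap φ r)
      = r.fst • seqIncl (Unitization ℂ A) 1 +
          SeqAlg.map (Unitization.inrNonUnitalStarAlgHom ℂ A) (ψ (φ r.snd)) := by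
        simp [unitizationSeqHom, Unitization.algebraMap_eq_inl]
    _ = seqIncl (Unitization ℂ A) (r.fst • 1 + Unitization.inrNonUnitalStarAlgHom ℂ A r.snd) := by
        rw [h, SeqAlg.map_seqIncl, map_add, map_smul]
    _ = seqIncl (Unitization ℂ A) r := congrArg _ (by ext <;> simp)

theorem SeqSplit.K0_map_injective {φ : A →⋆ₙₐ[ℂ] B} (hφ : SeqSplit φ) :
    Function.Injective (K0.map φ) := by
  obtain ⟨ψ, hψ⟩ := seqSplit_iff.1 hφ
  have hinj : Function.Injective (UnitalK0.map (Unitization.starMap φ)) :=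
    UnitalK0.map_injective <|
      MvNSemigroup.map_injective _ (unitizationSeqHom ψ) (unitizationSeqHom_starMap hψ)
  exact fun x y hxy => Subtype.ext (hinj (congrArg Subtype.val hxy))

theorem SeqSplit.K1_map_injective {φ : A →⋆ₙₐ[ℂ] B} (hφ : SeqSplit φ) :
    Function.Injective (K1.map φ) :=
  ((SeqSplit.id _).maxTensorMap hφ).K0_map_injective

theorem SeqSplit.K0Mod_map_injective {φ : A →⋆ₙₐ[ℂ] B} (hφ : SeqSplit φ) (n : ℕ) :
    Function.Injective (K0Mod.map n φ) :=
  (hφ.maxTensorMap (SeqSplit.id (mooreAlgebra n))).K0_map_injective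

theorem SeqSplit.K1Mod_map_injective {φ : A →⋆ₙₐ[ℂ] B} (hφ : SeqSplit φ) (n : ℕ) :
    Function.Injective (K1Mod.map n φ) :=
  (hφ.maxTensorMap (SeqSplit.id (mooreAlgebra n))).K1_map_injective

end Injectivity

end

theorem theorem2p7 {A : Type u} {B : Type v} [NonUnitalCStarAlgebra A] [NonUnitalCStarAlgebra B]
    (φ : A →⋆ₙₐ[ℂ] B) (hφ : SeqSplit φ) :
    (∀ (E : NonUnitalStarSubalgebra ℂ A) [IsClosed (E : Set A)], IsHereditary E →
      SeqSplit (hereditaryRestrict φ E)) ∧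
    (∀ J : ClosedIdeal A, SeqSplit (J.restrict φ) ∧ SeqSplit (J.quotientMap φ)) ∧
    Function.Injective (ClosedIdeal.map φ) ∧
    (∀ (C : Type w) (D : Type x) [NonUnitalCStarAlgebra C] [NonUnitalCStarAlgebra D]
      (ρ : C →⋆ₙₐ[ℂ] D), SeqSplit ρ → SeqSplit (MaxTensor.map φ ρ)) ∧
    (∀ a b : Cu A, Cu.map φ a ≤ Cu.map φ b ↔ a ≤ b) ∧
    (Function.Injective (K0.map φ) ∧ Function.Injective (K1.map φ) ∧
      ∀ n : ℕ, 2 ≤ n → Function.Injective (K0Mod.map n φ) ∧ Function.Injective (K1Mod.map n φ)) ∧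
    (∀ τ : TracialState A, ∃ τ' : TracialState B, ∀ a : A, τ' (φ a) = τ a) := by
  exact ⟨fun E _ hE => hφ.hereditaryRestrict E hE,
    fun J => ⟨hφ.idealRestrict J, hφ.quotientMap J⟩,
    hφ.idealMap_injective,
    fun C D _ _ ρ hρ => hφ.maxTensorMap hρ,
    hφ.cuMap_le_iff,
    ⟨hφ.K0_map_injective, hφ.K1_map_injective,
      fun n _ => ⟨hφ.K0Mod_map_injective n, hφ.K1Mod_map_injective n⟩⟩,
    hφ.exists_tracialState⟩
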